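/- Let $d\ge 1$, let $\mathbf E\subset\mathbb R^d$ be a compact convex set with non-empty interior, let $C\subseteq\mathbf E$ be a closed convex set of Lebesgue measure $|C|>0$, and let $\lambda>0$. Let $\mathcal N$ be a Poisson point process of intensity $\lambda$ on $C$, defined on a probability space $(\Omega,\mathcal A,\mathbb P)$: a measurable map from $\Omega$ to the space of $\mathbb N$-valued measures on the Borel sets of $\mathbf E$ such that $\mathcal N(A)\sim\mathrm{Poiss}(\lambda|A\cap C|)$ for every Borel set $A\subseteq\mathbf E$ and $\mathcal N(A_1),\dots,\mathcal N(A_n)$ are independent for mutually disjoint Borel sets $A_1,\dots,A_n\subseteq\mathbf E$. Let $\mathfrak F=\sigma(\mathcal N(U): U\subseteq\mathbf E\text{ compact})$. For compact $K\subseteq\mathbf E$ let $\mathcal F_K$ be the $\sigma$-algebra generated by the variables $\mathcal N(U)$, $U\subseteq K$ compact, completed with the $\mathbb P$-null sets in $\mathfrak F$. A stopping set is a random compact set $\mathcal K\subseteq\mathbf E$ (an $\mathfrak F$-measurable map into the compact subsets of $\mathbf E$, with the Borel $\sigma$-algebra of the Hausdorff metric) such that $\{\mathcal K\subseteq K\}\in\mathcal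 F_K$ for all compact $K\subseteq\mathbf E$; its history is $$\mathcal F_{\mathcal K}=\{A\in\mathfrak F:\ A\cap\{\mathcal K\subseteq K\}\in\mathcal F_K\ \text{ for all compact } K\subseteq\mathbf E\}.$$ Let $\hat C$ be the convex hull of the points of $\mathcal N$, let $\hat{\mathcal K}=\overline{\mathbf E\setminus\hat C}$, and let $N_\partial=\mathcal N(\partial\hat C)$ and $N_\circ=\mathcal N(\hat C^{\circ})$ be the numbers of points of $\mathcal N$ on the boundary and in the interior of $\hat C$. Then $\hat{\mathcal K}$ is a stopping set, and: (i) $N_\partial$ is $\mathcal F_{\hat{\mathcal K}}$-measurable; (ii) $N_\circ$ is a random variable which, conditionally on $\mathcal F_{\hat{\mathcal K}}$, is Poisson distributed with parameter $\lambda|\hat C|$, that is, for every $k\in\{0,1,2,\dots\}$, almost surely $$\mathbb P\bigl(N_\circ=k\,\big|\,\mathcal F_{\hat{\mathcal K}}\bigr)=e^{-\lambda|\hat C|}\,\frac{(\lambda|\hat C|)^k}{k!};$$ (iii) $\mathcal F_{\hat{\mathcal K}}=\sigma(\hat C)$, where $\sigma(\hat C)$ denotes the $\sigma$-algebra generated by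 the events $\{\hat C\subseteq B\}$, $B\subseteq\mathbf E$ closed and convex, completed with the $\mathbb P$-null sets in $\mathfrak F$. -/

import Mathlib

open MeasureTheory ProbabilityTheory TopologicalSpace
open scoped NNReal ENNReal

noncomputable section

namespace HullPPP

variable {d : ℕ} {Ω : Type*}

/-- The point measures on a compact state space `E ⊆ ℝᵈ`: the measures on the Borel sets of `E`
(viewed as Borel measures on `ℝᵈ` that vanish off `E`) all of whose values are natural numbers.
As a subtype of `Measure`, it carries the σ-algebra generated by the evaluations `m ↦ m A`. -/
abbrev PointMeasure (E : Compacts (EuclideanSpace ℝ (Fin d))) : Type :=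
  {m : Measure (EuclideanSpace ℝ (Fin d)) //
    m (E : Set (EuclideanSpace ℝ (Fin d)))ᶜ = 0 ∧
      ∀ A : Set (EuclideanSpace ℝ (Fin d)), MeasurableSet A → ∃ n : ℕ, m A = n}

variable {E : Compacts (EuclideanSpace ℝ (Fin d))}

/-- `𝒩` is a Poisson point process of intensity `lam` on `C`, with state space `E`. -/
structure IsPoissonPointProcess [MeasurableSpace Ω] (P : Measure Ω) (lam : ℝ≥0)
    (C : Set (EuclideanSpace ℝ (Fin d))) (𝒩 : Ω → PointMeasure E) : Prop where
  measurable : Measurable 𝒩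
  law : ∀ A : Set (EuclideanSpace ℝ (Fin d)), MeasurableSet A → A ⊆ E →
    P.map (fun ω => (𝒩 ω).1 A) =
      (poissonMeasure (lam * (volume (A ∩ C)).toNNReal)).map (Nat.cast : ℕ → ℝ≥0∞)
  indep : ∀ (n : ℕ) (A : Fin n → Set (EuclideanSpace ℝ (Fin d))),
    (∀ i, MeasurableSet (A i)) → (∀ i, A i ⊆ E) → Pairwise (fun i j => Disjoint (A i) (A j)) →
      iIndepFun (fun i ω => (𝒩 ω).1 (A i)) P

/-- The convex hull of the points (the atoms) of a point measure. -/
def hull (m : PointMeasure E) : Set (EuclideanSpace ℝ (Fin d)) :=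
  convexHull ℝ {x | m.1 {x} ≠ 0}

/-- The closure of the complement (in the state space `E`) of the convex hull. -/
def closedCompl (m : PointMeasure E) : Compacts (EuclideanSpace ℝ (Fin d)) where
  carrier := closure ((E : Set (EuclideanSpace ℝ (Fin d))) \ hull m)
  isCompact' := E.isCompact.closure_of_subset Set.sdiff_subset

/-- The number of points on the boundary of the convex hull. -/
def boundaryCount (m : PointMeasure E) : ℝ≥0∞ := m.1 (frontier (hull m))

/-- The number of points in the interior of the convex hull. -/
def interiorCount (m : PointMeasure E) : ℝ≥0∞ := m.1 (interior (hull m))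

/-- The σ-algebra `σ(𝒩(U) : U ⊆ K, U compact)`. -/
def countSigma (𝒩 : Ω → PointMeasure E) (K : Compacts (EuclideanSpace ℝ (Fin d))) :
    MeasurableSpace Ω :=
  ⨆ (U : Compacts (EuclideanSpace ℝ (Fin d))) (_ : U ≤ K),
    MeasurableSpace.comap (fun ω => (𝒩 ω).1 (U : Set (EuclideanSpace ℝ (Fin d)))) inferInstance

/-- The σ-algebra `m` completed with the null sets in `𝔉`, where `𝔉` is generated by the whole
process `(𝒩(K), K ⊆ E compact)`. -/
def complete [MeasurableSpace Ω] (P : Measure Ω) (𝒩 : Ω → PointMeasure E)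
    (m : MeasurableSpace Ω) : MeasurableSpace Ω :=
  m ⊔ MeasurableSpace.generateFrom {Z | MeasurableSet[countSigma 𝒩 E] Z ∧ P Z = 0}

/-- The natural set-indexed filtration of the process, completed with the null sets. -/
def natFiltration [MeasurableSpace Ω] (P : Measure Ω) (𝒩 : Ω → PointMeasure E)
    (K : Compacts (EuclideanSpace ℝ (Fin d))) : MeasurableSpace Ω :=
  complete P 𝒩 (countSigma 𝒩 K)

/-- The σ-algebra `σ(𝓕 K : K ⊆ E compact)` generated by a set-indexed filtration. -/
def totalSigma (E : Compacts (EuclideanSpace ℝ (Fin d)))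
    (𝓕 : Compacts (EuclideanSpace ℝ (Fin d)) → MeasurableSpace Ω) : MeasurableSpace Ω :=
  ⨆ (K : Compacts (EuclideanSpace ℝ (Fin d))) (_ : K ≤ E), 𝓕 K

/-- A stopping set: a random compact subset `𝒦` of `E` (measurable for the Borel σ-algebra of the
Hausdorff metric on compact sets) such that `{𝒦 ⊆ K} ∈ 𝓕 K` for every compact `K ⊆ E`. -/
structure IsStoppingSet (E : Compacts (EuclideanSpace ℝ (Fin d)))
    (𝓕 : Compacts (EuclideanSpace ℝ (Fin d)) → MeasurableSpace Ω)
    (𝒦 : Ω → Compacts (EuclideanSpace ℝ (Fin d))) : Prop where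
  subset : ∀ ω, 𝒦 ω ≤ E
  measurable : @Measurable Ω _ (totalSigma E 𝓕) (borel _) 𝒦
  measurableSet_le : ∀ K ≤ E, MeasurableSet[𝓕 K] {ω | 𝒦 ω ≤ K}

/-- The σ-algebra of the history of a stopping set. -/
def IsStoppingSet.history {𝓕 : Compacts (EuclideanSpace ℝ (Fin d)) → MeasurableSpace Ω}
    {𝒦 : Ω → Compacts (EuclideanSpace ℝ (Fin d))} (h : IsStoppingSet E 𝓕 𝒦) :
    MeasurableSpace Ω where
  MeasurableSet' A := MeasurableSet[totalSigma E 𝓕] A ∧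
    ∀ K ≤ E, MeasurableSet[𝓕 K] (A ∩ {ω | 𝒦 ω ≤ K})
  measurableSet_empty :=
    ⟨@MeasurableSet.empty _ (_), fun K _ => by
      rw [Set.empty_inter]; exact @MeasurableSet.empty _ (_)⟩
  measurableSet_compl A hA :=
    ⟨@MeasurableSet.compl _ _ (_) hA.1, fun K hK => by
      have e : Aᶜ ∩ {ω | 𝒦 ω ≤ K} = {ω | 𝒦 ω ≤ K} \ (A ∩ {ω | 𝒦 ω ≤ K}) := by
        ext ω; simp only [Set.mem_inter_iff, Set.mem_compl_iff, Set.mem_sdiff]; tauto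
      rw [e]
      exact @MeasurableSet.diff _ (_) _ _ (h.measurableSet_le K hK) (hA.2 K hK)⟩
  measurableSet_iUnion f hf :=
    ⟨@MeasurableSet.iUnion _ _ (_) _ _ fun i => (hf i).1, fun K hK => by
      rw [Set.iUnion_inter]
      exact @MeasurableSet.iUnion _ _ (_) _ _ fun i => (hf i).2 K hK⟩

/-- The σ-algebra `σ({hull ⊆ B} : B ⊆ E closed convex)` completed with the null sets. -/
def hullSigma [MeasurableSpace Ω] (P : Measure Ω) (𝒩 : Ω → PointMeasure E) :
    MeasurableSpace Ω :=
  complete P 𝒩 (MeasurableSpace.generateFrom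
    {s | ∃ B : Set (EuclideanSpace ℝ (Fin d)), Convex ℝ B ∧ IsClosed B ∧ B ⊆ E ∧
      s = {ω | hull (𝒩 ω) ⊆ B}})

end HullPPP

end

/-! The key point is deterministic. If no atom lies on `frontier E`, then every atom on the boundary
of the hull is a limit of points of `E \ hull m`, so it lies in `closedCompl m`
(`atoms_inter_frontier_subset`). Hence, once `closedCompl m ≤ K`, the vertices, the hull and the
boundary count can all be read off the restriction of `m` to `K`. The boundary of the convex set `E`
is Lebesgue null, so the process almost surely has no point there. This gives the stopping property,
claim (i) and the inclusion of `hullSigma` in the history.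

The conditional law comes from a strong Markov argument with discretisation. The interior of the
hull is exhausted by finite unions of cells from a countable basis, and for each `n` the index set
`fullCells m n` takes countably many values. On the event that it equals `I`, an event of the
history depends only on the process outside `cellUnion E I` (`measurableSet_inter_fullCells`). The
count inside is independent of that and Poisson. Summing over `I` and letting `n` tend to infinity
replaces the cells by the interior of the hull, whose volume is that of the hull because a convex
set has null boundary.

For the inclusion of the history in `hullSigma`, two almost sure facts are needed: all points are
simple (`ae_simple`), and all points on the boundary of the hull are extreme
(`ae_atoms_inter_frontier_subset`). Once the cells contain all interior points, the process outside
them is therefore the sum of Dirac masses at the vertices of the hull, so it is a function of the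
hull. That this function is measurable follows from Lusin separation: the hull is coded by the
countably many half-spaces containing it, the code is injective, and the codes of polytopes with
complementary vertex conditions form disjoint analytic sets. -/

noncomputable section

namespace HullPPP

/-! ### Convex geometry -/

section Geometry

variable {V : Type*} [NormedAddCommGroup V] [InnerProductSpace ℝ V]

/-- The closed half-space `{y | ⟪u, y⟫ ≤ q}`. -/
def halfSpace (u : V) (q : ℝ) : Set V := {y | inner ℝ u y ≤ q}

lemma isClosed_halfSpace (u : V) (q : ℝ) : IsClosed (halfSpace u q) :=
  isClosed_le (by fun_prop) continuous_const

lemma convex_halfSpace (u : V) (q : ℝ) : Convex ℝ (halfSpace u q) :=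
  convex_halfSpace_le (innerₛₗ ℝ u).isLinear q

/-- A point off a compact convex set is separated from it by a half-space from a countable
family. -/
lemma exists_halfSpace_separating [CompleteSpace V] [SeparableSpace V] {s : Set V}
    (hs : IsCompact s) (hc : Convex ℝ s) {x : V} (hx : x ∉ s) :
    ∃ (n : ℕ) (q : ℚ), s ⊆ halfSpace (denseSeq V n) q ∧ (q : ℝ) < inner ℝ (denseSeq V n) x := by
  obtain ⟨f, a, b, hfs, hab, hbx⟩ :=
    geometric_hahn_banach_compact_closed hc hs (convex_singleton x) isClosed_singleton
      (Set.disjoint_singleton_right.2 hx)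
  have hbx : b < f x := hbx x rfl
  obtain ⟨R, hR⟩ := (hs.union isCompact_singleton).isBounded.exists_norm_le (E := V) (s := s ∪ {x})
  have hR0 : 0 ≤ R := (norm_nonneg x).trans (hR x (by simp))
  set u := (InnerProductSpace.toDual ℝ V).symm f with hu
  have huf : ∀ y, inner ℝ u y = f y := fun y => by simp [hu]
  -- With this radius the pairing changes by less than half the gap `b - a` on `s ∪ {x}`, so the
  -- midpoint `(a + b) / 2` still separates. Using `R + 1` keeps the denominator positive.
  obtain ⟨n, hn⟩ := (denseRange_denseSeq V).exists_dist_lt u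
    (show 0 < (b - a) / (2 * (R + 1)) from div_pos (by linarith) (by linarith))
  have key : ∀ y ∈ s ∪ {x}, |inner ℝ (denseSeq V n) y - f y| < (b - a) / 2 := by
    intro y hy
    rw [← huf, ← inner_sub_left]
    calc |inner ℝ (denseSeq V n - u) y| ≤ ‖denseSeq V n - u‖ * ‖y‖ := abs_real_inner_le_norm _ _
      _ ≤ ‖denseSeq V n - u‖ * (R + 1) := by
          gcongr; linarith [hR y hy]
      _ < (b - a) / (2 * (R + 1)) * (R + 1) := by
          rw [dist_comm, dist_eq_norm] at hn
          exact mul_lt_mul_of_pos_right hn (by linarith)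
      _ = (b - a) / 2 := by field_simp
  obtain ⟨q, hq1, hq2⟩ := exists_rat_btwn
    (show (a + b) / 2 < inner ℝ (denseSeq V n) x by
      have := (abs_lt.1 (key x (by simp))).1; linarith)
  refine ⟨n, q, fun y hy => ?_, hq2⟩
  have h1 := (abs_lt.1 (key y (Or.inl hy))).2
  have h2 := hfs y hy
  simp only [halfSpace, Set.mem_ofPred_eq]
  linarith

/-- The convex hull of a finite set is the convex hull of its extreme points. -/
lemma convexHull_extremePoints_convexHull {s : Set V} (hs : s.Finite) :
    convexHull ℝ ((convexHull ℝ s).extremePoints ℝ) = convexHull ℝ s := by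
  have hf : ((convexHull ℝ s).extremePoints ℝ).Finite :=
    hs.subset extremePoints_convexHull_subset
  rw [← (hf.isCompact_convexHull ℝ).isClosed.closure_eq]
  exact closure_convexHull_extremePoints (hs.isCompact_convexHull ℝ) (convex_convexHull ℝ s)

/-- A point of a finite set that is not in the hull of the other points is extreme in the hull. -/
lemma mem_extremePoints_of_notMem_convexHull {s : Set V} (hs : s.Finite) {x : V} (hx : x ∈ s)
    (h : x ∉ convexHull ℝ (s \ {x})) : x ∈ (convexHull ℝ s).extremePoints ℝ := by
  by_contra hne
  apply h
  have hsub : (convexHull ℝ s).extremePoints ℝ ⊆ s \ {x} := fun y hy =>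
    ⟨extremePoints_convexHull_subset hy, by rintro rfl; exact hne hy⟩
  exact convexHull_mono hsub
    (by rw [convexHull_extremePoints_convexHull hs]; exact subset_convexHull ℝ s hx)

end Geometry

/-! ### Point measures -/

variable {d : ℕ} {E : Compacts (EuclideanSpace ℝ (Fin d))}

/-- The set of atoms of a point measure. -/
def atoms (m : PointMeasure E) : Set (EuclideanSpace ℝ (Fin d)) := {x | m.1 {x} ≠ 0}

lemma hull_eq (m : PointMeasure E) : hull m = convexHull ℝ (atoms m) := rfl

instance (m : PointMeasure E) : IsFiniteMeasure m.1 :=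
  ⟨by obtain ⟨n, hn⟩ := m.2.2 Set.univ .univ; simp [hn]⟩

lemma one_le_of_ne_zero (m : PointMeasure E) {A : Set (EuclideanSpace ℝ (Fin d))}
    (hA : MeasurableSet A) (h : m.1 A ≠ 0) : 1 ≤ m.1 A := by
  obtain ⟨n, hn⟩ := m.2.2 A hA
  rw [hn] at h ⊢
  exact_mod_cast Nat.one_le_iff_ne_zero.2 (by exact_mod_cast h)

/-- Each atom has mass at least one and the total mass is finite. -/
lemma finite_atoms (m : PointMeasure E) : (atoms m).Finite := by
  by_contra h
  exact measure_ne_top m.1 _ (Set.Infinite.meas_eq_top h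
    ⟨1, one_ne_zero, fun x hx => one_le_of_ne_zero m (measurableSet_singleton x) hx⟩)

/-- By outer regularity a point of mass zero has an open neighbourhood of mass below one, hence of
mass zero since masses are integers. Locally null sets are null. -/
lemma measure_compl_atoms (m : PointMeasure E) : m.1 (atoms m)ᶜ = 0 := by
  refine measure_null_of_locally_null _ fun x hx => ?_
  have hx : m.1 {x} < 1 := by
    have : m.1 {x} = 0 := by simpa [atoms] using hx
    simp [this]
  obtain ⟨U, hU, hUo, hU1⟩ := Set.exists_isOpen_lt_of_lt _ _ hx
  refine ⟨U, mem_nhdsWithin_of_mem_nhds (hUo.mem_nhds (hU rfl)), ?_⟩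
  by_contra h
  exact absurd (one_le_of_ne_zero m hUo.measurableSet h) (not_le.2 hU1)

lemma measure_eq_zero_iff (m : PointMeasure E) (A : Set (EuclideanSpace ℝ (Fin d))) :
    m.1 A = 0 ↔ Disjoint A (atoms m) := by
  constructor
  · intro h
    refine Set.disjoint_left.2 fun x hx hxa => hxa ?_
    exact measure_mono_null (Set.singleton_subset_iff.2 hx) h
  · intro h
    exact measure_mono_null (Set.subset_compl_iff_disjoint_right.2 h) (measure_compl_atoms m)

lemma measure_congr_atoms (m : PointMeasure E) {A B : Set (EuclideanSpace ℝ (Fin d))}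
    (h : ∀ x ∈ atoms m, x ∈ A ↔ x ∈ B) : m.1 A = m.1 B := by
  refine measure_congr ?_
  have : ∀ᵐ x ∂m.1, x ∈ atoms m := measure_compl_atoms m
  filter_upwards [this] with x hx
  exact propext (h x hx)

lemma atoms_subset (m : PointMeasure E) : atoms m ⊆ E := fun x hx => by
  by_contra h
  exact Set.disjoint_left.1 ((measure_eq_zero_iff m _).1 m.2.1) h hx

lemma atoms_subset_hull (m : PointMeasure E) : atoms m ⊆ hull m := subset_convexHull ℝ _

lemma isCompact_hull (m : PointMeasure E) : IsCompact (hull m) :=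
  (finite_atoms m).isCompact_convexHull ℝ

lemma isClosed_hull (m : PointMeasure E) : IsClosed (hull m) := (isCompact_hull m).isClosed

lemma convex_hull (m : PointMeasure E) : Convex ℝ (hull m) := convex_convexHull ℝ _

lemma hull_subset (hE : Convex ℝ (E : Set (EuclideanSpace ℝ (Fin d)))) (m : PointMeasure E) :
    hull m ⊆ E :=
  convexHull_min (atoms_subset m) hE

lemma hull_subset_iff (m : PointMeasure E) {B : Set (EuclideanSpace ℝ (Fin d))}
    (hB : Convex ℝ B) : hull m ⊆ B ↔ m.1 Bᶜ = 0 := by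
  rw [measure_eq_zero_iff, hull_eq, hB.convexHull_subset_iff, Set.disjoint_compl_left_iff_subset]

/-- Expresses membership by countably many evaluations of `m`, which gives joint measurability in
the configuration and the point. -/
lemma mem_hull_iff (m : PointMeasure E) (x : EuclideanSpace ℝ (Fin d)) :
    x ∈ hull m ↔ ∀ (n : ℕ) (q : ℚ), m.1 (halfSpace (denseSeq _ n) q)ᶜ = 0 →
      x ∈ halfSpace (denseSeq _ n) q := by
  constructor
  · intro hx n q h
    exact (hull_subset_iff m (convex_halfSpace _ _)).2 h hx
  · intro h
    by_contra hx
    obtain ⟨n, q, h1, h2⟩ := exists_halfSpace_separating (isCompact_hull m) (convex_hull m) hx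
    exact absurd (h n q ((hull_subset_iff m (convex_halfSpace _ _)).1 h1)) (not_le.2 h2)

/-- The extreme points of the hull of a point measure. -/
def vertices (m : PointMeasure E) : Set (EuclideanSpace ℝ (Fin d)) :=
  (hull m).extremePoints ℝ

lemma vertices_subset_atoms (m : PointMeasure E) : vertices m ⊆ atoms m :=
  extremePoints_convexHull_subset

lemma finite_vertices (m : PointMeasure E) : (vertices m).Finite :=
  (finite_atoms m).subset (vertices_subset_atoms m)

lemma convexHull_vertices (m : PointMeasure E) : convexHull ℝ (vertices m) = hull m :=
  convexHull_extremePoints_convexHull (finite_atoms m)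

/-- Positive dimension is essential: in dimension zero the single point is both extreme and
interior. -/
lemma vertices_subset_frontier (hd : 0 < d) (m : PointMeasure E) :
    vertices m ⊆ frontier (hull m) := fun x hx => by
  have : Nonempty (Fin d) := ⟨⟨0, hd⟩⟩
  rw [(isClosed_hull m).frontier_eq]
  exact ⟨hx.1, fun h => Set.disjoint_left.1 (disjoint_interior_extremePoints (hull m)) h hx⟩

/-- The restriction of a point measure to a closed set. -/
def restr (m : PointMeasure E) (F : Closeds (EuclideanSpace ℝ (Fin d))) : PointMeasure E :=
  ⟨m.1.restrict F, Measure.restrict_le_self.absolutelyContinuous m.2.1, fun A hA => by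
    rw [Measure.restrict_apply hA]
    exact m.2.2 _ (hA.inter F.isClosed.measurableSet)⟩

lemma atoms_restr (m : PointMeasure E) (F : Closeds (EuclideanSpace ℝ (Fin d))) :
    atoms (restr m F) = atoms m ∩ F := by
  ext x
  simp only [atoms, restr, Set.mem_ofPred_eq, Set.mem_inter_iff, SetLike.mem_coe]
  rw [Measure.restrict_apply (measurableSet_singleton x)]
  by_cases hx : x ∈ F
  · rw [Set.inter_eq_left.2 (Set.singleton_subset_iff.2 hx)]; simp [hx]
  · have : ({x} : Set (EuclideanSpace ℝ (Fin d))) ∩ F = ∅ := by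
      rw [Set.singleton_inter_eq_empty]; exact hx
    simp [this, hx]

lemma hull_restr_subset (m : PointMeasure E) (F : Closeds (EuclideanSpace ℝ (Fin d))) :
    hull (restr m F) ⊆ hull m :=
  convexHull_mono (by
    change atoms (restr m F) ⊆ atoms m
    rw [atoms_restr]; exact Set.inter_subset_left)

lemma hull_restr_eq (m : PointMeasure E) {F : Closeds (EuclideanSpace ℝ (Fin d))}
    (h : vertices m ⊆ F) : hull (restr m F) = hull m := by
  refine (hull_restr_subset m F).antisymm ?_
  rw [← convexHull_vertices, hull_eq, atoms_restr]
  exact convexHull_mono fun x hx => ⟨vertices_subset_atoms m hx, h hx⟩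

lemma restr_eq_self (m : PointMeasure E) {F : Closeds (EuclideanSpace ℝ (Fin d))}
    (h : atoms m ⊆ F) : restr m F = m := by
  refine Subtype.ext (Measure.restrict_eq_self_of_ae_mem ?_)
  exact measure_mono_null (Set.compl_subset_compl.2 h) (measure_compl_atoms m)

/-! ### Measurability of functionals of the hull -/

section Measurability

lemma measurable_of_countable_cases {α β ι : Type*} [MeasurableSpace α] [MeasurableSpace β]
    [Countable ι] {g : α → ι} (hg : ∀ i, MeasurableSet {a | g a = i}) {f : ι → α → β}
    (hf : ∀ i, Measurable (f i)) : Measurable fun a => f (g a) a := fun T hT => by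
  have : (fun a => f (g a) a) ⁻¹' T = ⋃ i, {a | g a = i} ∩ f i ⁻¹' T := by
    ext a; simp
  rw [this]
  exact .iUnion fun i => (hg i).inter (hf i hT)

lemma measurable_eval {A : Set (EuclideanSpace ℝ (Fin d))} (hA : MeasurableSet A) :
    Measurable fun m : PointMeasure E => m.1 A :=
  (Measure.measurable_coe hA).comp measurable_subtype_coe

lemma measurableSet_hull_subset {B : Set (EuclideanSpace ℝ (Fin d))} (hB : Convex ℝ B)
    (hB' : IsClosed B) : MeasurableSet {m : PointMeasure E | hull m ⊆ B} := by
  simp only [hull_subset_iff _ hB]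
  exact measurable_eval hB'.measurableSet.compl (measurableSet_singleton 0)

lemma measurableSet_mem_hull :
    MeasurableSet {p : PointMeasure E × EuclideanSpace ℝ (Fin d) | p.2 ∈ hull p.1} := by
  simp only [mem_hull_iff]
  have : {p : PointMeasure E × EuclideanSpace ℝ (Fin d) |
      ∀ (n : ℕ) (q : ℚ), p.1.1 (halfSpace (denseSeq _ n) q)ᶜ = 0 →
        p.2 ∈ halfSpace (denseSeq _ n) q} =
      ⋂ (n : ℕ) (q : ℚ), ({p | p.1.1 (halfSpace (denseSeq _ n) q)ᶜ = 0}ᶜ ∪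
        {p | p.2 ∈ halfSpace (denseSeq _ n) q}) := by
    ext p
    simp only [Set.mem_ofPred_eq, Set.mem_iInter, Set.mem_union, Set.mem_compl_iff, imp_iff_not_or]
  rw [this]
  refine .iInter fun n => .iInter fun q => .union (.compl ?_) ?_
  · exact ((measurable_eval (isClosed_halfSpace _ _).measurableSet.compl).comp measurable_fst)
      (measurableSet_singleton 0)
  · exact measurable_snd (isClosed_halfSpace _ _).measurableSet

/-- The hull is closed, so a countable dense subset of `W` suffices. -/
lemma measurableSet_subset_hull (W : Set (EuclideanSpace ℝ (Fin d))) :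
    MeasurableSet {m : PointMeasure E | W ⊆ hull m} := by
  obtain ⟨c, hcW, hc, hWc⟩ := (IsSeparable.of_separableSpace W).exists_countable_dense_subset
  have : {m : PointMeasure E | W ⊆ hull m} = ⋂ x ∈ c, {m | x ∈ hull m} := by
    ext m
    simp only [Set.mem_ofPred_eq, Set.mem_iInter]
    exact ⟨fun h x hx => h (hcW hx), fun h => hWc.trans (closure_minimal h (isClosed_hull m))⟩
  rw [this]
  exact .biInter hc fun x _ => measurableSet_mem_hull.preimage measurable_prodMk_right

lemma measurable_volume_hull : Measurable fun m : PointMeasure E => volume (hull m) :=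
  measurable_measure_prodMk_left (ν := volume) measurableSet_mem_hull

/-! ### Exhausting the interior of the hull by countably many cells -/

lemma exists_basis_seq : ∃ B : ℕ → Set (EuclideanSpace ℝ (Fin d)),
    IsTopologicalBasis (Set.range B) := by
  obtain ⟨b, hb, -, hB⟩ := exists_countable_basis (EuclideanSpace ℝ (Fin d))
  have hne : b.Nonempty := by
    obtain ⟨s, hs, -⟩ := Set.mem_sUnion.1
      (hB.sUnion_eq ▸ Set.mem_univ (0 : EuclideanSpace ℝ (Fin d)))
    exact ⟨s, hs⟩
  obtain ⟨f, rfl⟩ := hb.exists_eq_range hne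
  exact ⟨f, hB⟩

/-- An enumeration of a countable basis of the topology of `ℝᵈ`. -/
def basisSeq (d : ℕ) : ℕ → Set (EuclideanSpace ℝ (Fin d)) := exists_basis_seq.choose

lemma isTopologicalBasis_basisSeq : IsTopologicalBasis (Set.range (basisSeq d)) :=
  exists_basis_seq.choose_spec

lemma isOpen_basisSeq (i : ℕ) : IsOpen (basisSeq d i) :=
  isTopologicalBasis_basisSeq.isOpen ⟨i, rfl⟩

/-- A countable basis of the topology of the interior of `E`. -/
def cell (E : Compacts (EuclideanSpace ℝ (Fin d))) (i : ℕ) : Set (EuclideanSpace ℝ (Fin d)) :=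
  basisSeq d i ∩ interior E

lemma isOpen_cell (i : ℕ) : IsOpen (cell E i) := (isOpen_basisSeq i).inter isOpen_interior

/-- A finite union of cells. -/
def cellUnion (E : Compacts (EuclideanSpace ℝ (Fin d))) (I : Finset ℕ) :
    Set (EuclideanSpace ℝ (Fin d)) := ⋃ i ∈ I, cell E i

lemma isOpen_cellUnion (I : Finset ℕ) : IsOpen (cellUnion E I) :=
  isOpen_biUnion fun i _ => isOpen_cell i

lemma cellUnion_subset (I : Finset ℕ) : cellUnion E I ⊆ E :=
  Set.iUnion₂_subset fun _ _ => Set.inter_subset_right.trans interior_subset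

open Classical in
/-- The indices below `n` of the cells contained in the hull. -/
def fullCells (m : PointMeasure E) (n : ℕ) : Finset ℕ :=
  (Finset.range n).filter fun i => cell E i ⊆ hull m

lemma mem_fullCells {m : PointMeasure E} {n i : ℕ} :
    i ∈ fullCells m n ↔ i < n ∧ cell E i ⊆ hull m := by
  simp [fullCells]

lemma measurableSet_fullCells_eq_of {α : Type*} [MeasurableSpace α] {f : α → PointMeasure E}
    (hf : ∀ i, MeasurableSet {a | cell E i ⊆ hull (f a)}) (n : ℕ) (I : Finset ℕ) :
    MeasurableSet {a | fullCells (f a) n = I} := by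
  have : {a | fullCells (f a) n = I} =
      ⋂ i, {a | (i < n ∧ cell E i ⊆ hull (f a)) ↔ i ∈ I} := by
    ext a
    simp only [Set.mem_ofPred_eq, Set.mem_iInter, Finset.ext_iff, mem_fullCells]
  rw [this]
  refine .iInter fun i => ?_
  by_cases hi : i < n <;> by_cases hI : i ∈ I <;> simp only [hi, hI, true_and, false_and, iff_true,
    iff_false, MeasurableSet.const]
  · exact hf i
  · exact (hf i).compl

lemma measurableSet_fullCells_eq (n : ℕ) (I : Finset ℕ) :
    MeasurableSet {m : PointMeasure E | fullCells m n = I} :=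
  measurableSet_fullCells_eq_of (f := id) (fun i => measurableSet_subset_hull (cell E i)) n I

lemma cellUnion_fullCells_mono (m : PointMeasure E) :
    Monotone fun n => cellUnion E (fullCells m n) := fun a b hab =>
  Set.biUnion_subset_biUnion_left fun i hi => by
    have hi := mem_fullCells.1 (show i ∈ fullCells m a from hi)
    exact mem_fullCells.2 ⟨hi.1.trans_le hab, hi.2⟩

lemma cellUnion_fullCells_subset (m : PointMeasure E) (n : ℕ) :
    cellUnion E (fullCells m n) ⊆ hull m :=
  Set.iUnion₂_subset fun _ hi => (mem_fullCells.1 hi).2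

lemma iUnion_cellUnion_fullCells (hE : Convex ℝ (E : Set (EuclideanSpace ℝ (Fin d))))
    (m : PointMeasure E) : ⋃ n, cellUnion E (fullCells m n) = interior (hull m) := by
  refine Set.Subset.antisymm (Set.iUnion_subset fun n =>
    interior_maximal (cellUnion_fullCells_subset m n) (isOpen_cellUnion _)) fun x hx => ?_
  obtain ⟨_, ⟨i, rfl⟩, hxi, hi⟩ :=
    isTopologicalBasis_basisSeq.exists_subset_of_mem_open hx isOpen_interior
  have h1 : cell E i ⊆ hull m := Set.inter_subset_left.trans (hi.trans interior_subset)
  exact Set.mem_iUnion.2 ⟨i + 1, Set.mem_biUnion (mem_fullCells.2 ⟨i.lt_succ_self, h1⟩)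
    ⟨hxi, interior_mono (hull_subset hE m) hx⟩⟩

lemma interiorCount_eq_iSup (hE : Convex ℝ (E : Set (EuclideanSpace ℝ (Fin d))))
    (m : PointMeasure E) : interiorCount m = ⨆ n, m.1 (cellUnion E (fullCells m n)) := by
  rw [interiorCount, ← iUnion_cellUnion_fullCells hE,
    (cellUnion_fullCells_mono m).measure_iUnion]

lemma measurable_interiorCount (hE : Convex ℝ (E : Set (EuclideanSpace ℝ (Fin d)))) :
    Measurable (interiorCount : PointMeasure E → ℝ≥0∞) := by
  rw [funext (interiorCount_eq_iSup hE)]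
  exact .iSup fun n => measurable_of_countable_cases (measurableSet_fullCells_eq n)
    fun I => measurable_eval (isOpen_cellUnion I).measurableSet

/-- All atoms lie in the closed hull, so those off its interior are on its boundary. -/
lemma boundaryCount_eq (m : PointMeasure E) :
    boundaryCount m = m.1 Set.univ - interiorCount m := by
  rw [boundaryCount, interiorCount, ← measure_compl isOpen_interior.measurableSet (by simp)]
  refine measure_congr_atoms m fun x hx => ?_
  simp [(isClosed_hull m).frontier_eq, atoms_subset_hull m hx]

lemma measurable_boundaryCount (hE : Convex ℝ (E : Set (EuclideanSpace ℝ (Fin d)))) :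
    Measurable (boundaryCount : PointMeasure E → ℝ≥0∞) := by
  rw [funext boundaryCount_eq]
  exact (measurable_eval .univ).sub (measurable_interiorCount hE)

/-! ### Borel measurability of the closed complement for the Hausdorff metric -/

lemma closedCompl_le_iff (m : PointMeasure E) (K : Compacts (EuclideanSpace ℝ (Fin d))) :
    closedCompl m ≤ K ↔ (E : Set (EuclideanSpace ℝ (Fin d))) \ K ⊆ hull m := by
  change closure _ ⊆ (K : Set (EuclideanSpace ℝ (Fin d))) ↔ _
  rw [K.isCompact.isClosed.closure_subset_iff, Set.sdiff_subset_comm]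

lemma closedCompl_inter_nonempty_iff (m : PointMeasure E) {U : Set (EuclideanSpace ℝ (Fin d))}
    (hU : IsOpen U) : ((closedCompl m : Set (EuclideanSpace ℝ (Fin d))) ∩ U).Nonempty ↔
      ¬ ↑E ∩ U ⊆ hull m := by
  change (closure (↑E \ hull m) ∩ U).Nonempty ↔ _
  rw [closure_inter_open_nonempty_iff hU, Set.not_subset]
  simp only [Set.Nonempty, Set.mem_inter_iff, Set.mem_sdiff]
  exact exists_congr fun x => by tauto

/-- Compactness keeps the closed complement at positive distance from `E \ U`, which turns
containment in an open set into a countable union of events. -/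
lemma closedCompl_subset_iff (m : PointMeasure E) {U : Set (EuclideanSpace ℝ (Fin d))}
    (hU : IsOpen U) : (closedCompl m : Set (EuclideanSpace ℝ (Fin d))) ⊆ U ↔
      ∃ n : ℕ, ↑E ∩ Metric.thickening (1 / ((n : ℝ) + 1)) (↑E ∩ Uᶜ) ⊆ hull m := by
  constructor
  · intro h
    obtain ⟨δ, hδ, hsub⟩ :=
      (E.isCompact.inter_right hU.isClosed_compl).exists_thickening_subset_open
      (closedCompl m).isCompact.isClosed.isOpen_compl (fun x hx hx' => hx.2 (h hx'))
    obtain ⟨n, hn⟩ := exists_nat_one_div_lt hδ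
    refine ⟨n, fun x hx => ?_⟩
    by_contra hxh
    exact hsub (Metric.thickening_mono hn.le _ hx.2) (subset_closure ⟨hx.1, hxh⟩)
  · rintro ⟨n, hn⟩ x hx
    by_contra hxU
    have h1 : x ∈ Metric.thickening (1 / ((n : ℝ) + 1)) (↑E ∩ Uᶜ) :=
      Metric.self_subset_thickening (by positivity) _
        ⟨closure_minimal Set.sdiff_subset E.isCompact.isClosed hx, hxU⟩
    exact (closedCompl_inter_nonempty_iff m Metric.isOpen_thickening).1 ⟨x, hx, h1⟩ hn

lemma measurable_closedCompl :
    @Measurable _ _ _ (borel _)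
      (closedCompl : PointMeasure E → Compacts (EuclideanSpace ℝ (Fin d))) := by
  -- The Hausdorff topology is the Vietoris one: its subbasis consists of the compact sets contained
  -- in, or meeting, a given open set.
  rw [borel_eq_generateFrom_of_subbasis
    (induced_generateFrom_eq : (Compacts.topology : TopologicalSpace (Compacts _)) = _)]
  refine measurable_generateFrom ?_
  rintro _ ⟨_, ⟨U, hU, rfl⟩ | ⟨U, hU, rfl⟩, rfl⟩
  · have : (closedCompl : PointMeasure E → _) ⁻¹' ((↑) ⁻¹' U.powerset) =
        ⋃ n : ℕ, {m | ↑E ∩ Metric.thickening (1 / ((n : ℝ) + 1)) (↑E ∩ Uᶜ) ⊆ hull m} := by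
      ext m
      simpa using closedCompl_subset_iff m hU
    rw [this]
    exact .iUnion fun n => measurableSet_subset_hull _
  · have : (closedCompl : PointMeasure E → _) ⁻¹' ((↑) ⁻¹' {s | (s ∩ U).Nonempty}) =
        {m | ↑E ∩ U ⊆ hull m}ᶜ := by
      ext m
      simpa using closedCompl_inter_nonempty_iff m hU
    exact this ▸ (measurableSet_subset_hull _).compl

end Measurability

variable {Ω : Type*}

/-! ### The σ-algebras of the process -/

section Sigma

/-- Closed sets form a π-system generating the Borel sets, and their intersections with `K` are
compact. Events seen inside `K` thus become measurable conditions on the restricted configuration.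
-/
lemma countSigma_eq_comap (𝒩 : Ω → PointMeasure E) (K : Compacts (EuclideanSpace ℝ (Fin d))) :
    countSigma 𝒩 K = MeasurableSpace.comap (fun ω => restr (𝒩 ω) K.toCloseds) inferInstance := by
  apply le_antisymm
  · refine iSup₂_le fun U hU => ?_
    rw [← measurable_iff_comap_le]
    have h1 : (fun ω => (𝒩 ω).1 (U : Set (EuclideanSpace ℝ (Fin d)))) =
        fun ω => (restr (𝒩 ω) K.toCloseds).1 U := by
      ext ω
      change _ = (𝒩 ω).1.restrict K U
      rw [Measure.restrict_apply U.isCompact.measurableSet, Set.inter_eq_left.2 hU]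
    rw [h1]
    exact (measurable_eval U.isCompact.measurableSet).comp (comap_measurable _)
  · rw [← measurable_iff_comap_le]
    refine @Measurable.subtype_mk _ _ (countSigma 𝒩 K) _ _ _ ?_ _
    let _ := countSigma 𝒩 K
    have key : ∀ U ≤ K, Measurable fun ω => (𝒩 ω).1 (U : Set (EuclideanSpace ℝ (Fin d))) :=
      fun U hU => measurable_iff_comap_le.2 (le_iSup₂_of_le U hU le_rfl)
    refine Measurable.measure_of_isPiSystem (S := {s | IsClosed s})
      (BorelSpace.measurable_eq.trans borel_eq_generateFrom_isClosed) isPiSystem_isClosed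
      (fun F hF => ?_) ?_
    · have hF : IsClosed F := hF
      simp only [Measure.restrict_apply hF.measurableSet]
      exact key ⟨F ∩ K, K.isCompact.inter_left hF⟩ Set.inter_subset_right
    · simp only [Measure.restrict_apply_univ]
      exact key K le_rfl

lemma measurable_restr (𝒩 : Ω → PointMeasure E) (K : Compacts (EuclideanSpace ℝ (Fin d))) :
    Measurable[countSigma 𝒩 K] fun ω => restr (𝒩 ω) K.toCloseds := by
  rw [countSigma_eq_comap]; exact comap_measurable _

lemma measurable_process (𝒩 : Ω → PointMeasure E) : Measurable[countSigma 𝒩 E] 𝒩 := by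
  have h : (fun ω => restr (𝒩 ω) E.toCloseds) = 𝒩 :=
    funext fun ω => restr_eq_self _ (atoms_subset _)
  simpa only [h] using measurable_restr 𝒩 E

lemma countSigma_mono (𝒩 : Ω → PointMeasure E) {K L : Compacts (EuclideanSpace ℝ (Fin d))}
    (h : K ≤ L) : countSigma 𝒩 K ≤ countSigma 𝒩 L :=
  iSup₂_le fun U hU => le_iSup₂_of_le U (hU.trans h) le_rfl

/-- The σ-algebra of the events of `m'` that agree almost surely with an event of `m`. -/
@[reducible] def aeEvents (m m' : MeasurableSpace Ω) [MeasurableSpace Ω] (P : Measure Ω) :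
    MeasurableSpace Ω where
  MeasurableSet' A := MeasurableSet[m'] A ∧ ∃ B, MeasurableSet[m] B ∧ A =ᵐ[P] B
  measurableSet_empty :=
    ⟨@MeasurableSet.empty _ (_), ∅, @MeasurableSet.empty _ (_), ae_eq_refl _⟩
  measurableSet_compl A := fun ⟨hA, B, hB, h⟩ =>
    ⟨@MeasurableSet.compl _ _ (_) hA, Bᶜ, @MeasurableSet.compl _ _ (_) hB, h.compl⟩
  measurableSet_iUnion f hf := by
    choose h1 B hB h2 using hf
    exact ⟨@MeasurableSet.iUnion _ _ (_) _ _ h1, ⋃ i, B i,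
      @MeasurableSet.iUnion _ _ (_) _ _ hB, Filter.EventuallyEq.countable_iUnion h2⟩

/-- The completion of `m` consists of the events of the process that agree almost surely with
an event of `m`. -/
lemma measurableSet_complete_iff {m : MeasurableSpace Ω} [MeasurableSpace Ω] {P : Measure Ω}
    {𝒩 : Ω → PointMeasure E} (hm : m ≤ countSigma 𝒩 E) {A : Set Ω} :
    MeasurableSet[complete P 𝒩 m] A ↔
      MeasurableSet[countSigma 𝒩 E] A ∧ ∃ B, MeasurableSet[m] B ∧ A =ᵐ[P] B := by
  constructor
  · have hle : complete P 𝒩 m ≤ aeEvents m (countSigma 𝒩 E) P := by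
      refine sup_le (fun A hA => ⟨hm A hA, A, hA, ae_eq_refl _⟩)
        (MeasurableSpace.generateFrom_le fun Z hZ => ⟨hZ.1, ∅, @MeasurableSet.empty _ (_), ?_⟩)
      exact ae_eq_empty.2 hZ.2
    exact fun hA => hle A hA
  · rintro ⟨hA, B, hB, h⟩
    have hB' := hm B hB
    have hBc : MeasurableSet[complete P 𝒩 m] B := (le_sup_left : m ≤ complete P 𝒩 m) B hB
    have hnull : ∀ Z, MeasurableSet[countSigma 𝒩 E] Z → P Z = 0 →
        MeasurableSet[complete P 𝒩 m] Z := fun Z hZ hZ0 =>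
      (le_sup_right : _ ≤ complete P 𝒩 m) Z (MeasurableSpace.measurableSet_generateFrom ⟨hZ, hZ0⟩)
    have h1 := hnull (A \ B) (@MeasurableSet.diff _ (_) _ _ hA hB') (ae_le_set.1 h.le)
    have h2 := hnull (B \ A) (@MeasurableSet.diff _ (_) _ _ hB' hA) (ae_le_set.1 h.symm.le)
    have : A = (B \ (B \ A)) ∪ (A \ B) := by
      ext ω; simp only [Set.mem_union, Set.mem_sdiff]; tauto
    rw [this]
    exact @MeasurableSet.union _ (_) _ _ (@MeasurableSet.diff _ (_) _ _ hBc h2) h1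

variable [mΩ : MeasurableSpace Ω] {P : Measure Ω} {𝒩 : Ω → PointMeasure E}

lemma countSigma_le (h : Measurable 𝒩) (K : Compacts (EuclideanSpace ℝ (Fin d))) :
    countSigma 𝒩 K ≤ mΩ :=
  iSup₂_le fun U _ => measurable_iff_comap_le.1
    ((measurable_eval U.isCompact.measurableSet).comp h)

lemma measurableSet_natFiltration_iff {K : Compacts (EuclideanSpace ℝ (Fin d))} (hK : K ≤ E)
    {A : Set Ω} : MeasurableSet[natFiltration P 𝒩 K] A ↔
      MeasurableSet[countSigma 𝒩 E] A ∧ ∃ B, MeasurableSet[countSigma 𝒩 K] B ∧ A =ᵐ[P] B :=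
  measurableSet_complete_iff (countSigma_mono 𝒩 hK)

lemma natFiltration_mono {K L : Compacts (EuclideanSpace ℝ (Fin d))} (h : K ≤ L) :
    natFiltration P 𝒩 K ≤ natFiltration P 𝒩 L :=
  sup_le_sup_right (countSigma_mono 𝒩 h) _

lemma totalSigma_natFiltration :
    totalSigma E (natFiltration P 𝒩) = countSigma 𝒩 E := by
  apply le_antisymm
  · exact iSup₂_le fun K hK A hA => ((measurableSet_natFiltration_iff hK).1 hA).1
  · exact le_iSup₂_of_le E le_rfl le_sup_left

end Sigma

/-! ### The complement of the hull is a stopping set -/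

section Stopping

/-- Near a point of `interior E` the complement of the hull can be approached inside `E`. On
`frontier E` this may fail, so atoms there must be excluded. -/
lemma atoms_inter_frontier_subset {m : PointMeasure E}
    (hm : m.1 (frontier (E : Set (EuclideanSpace ℝ (Fin d)))) = 0)
    {K : Compacts (EuclideanSpace ℝ (Fin d))} (h : closedCompl m ≤ K) :
    atoms m ∩ frontier (hull m) ⊆ K := by
  rintro x ⟨hx, hxf⟩
  have hxE : x ∈ interior (E : Set (EuclideanSpace ℝ (Fin d))) := by
    by_contra hxi
    refine Set.disjoint_left.1 ((measure_eq_zero_iff m _).1 hm) ?_ hx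
    rw [E.isCompact.isClosed.frontier_eq]
    exact ⟨atoms_subset m hx, hxi⟩
  apply h
  change x ∈ closure (↑E \ hull m)
  have hcl : x ∈ closure (hull m)ᶜ := by
    rw [closure_compl]; exact hxf.2
  rw [mem_closure_iff] at hcl ⊢
  intro o ho hxo
  obtain ⟨y, hy, hyc⟩ := hcl (o ∩ interior E) (ho.inter isOpen_interior) ⟨hxo, hxE⟩
  exact ⟨y, hy.1, interior_subset hy.2, hyc⟩

lemma hull_restr_of_closedCompl_le (hd : 0 < d) {m : PointMeasure E}
    (hm : m.1 (frontier (E : Set (EuclideanSpace ℝ (Fin d)))) = 0)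
    {K : Compacts (EuclideanSpace ℝ (Fin d))} (h : closedCompl m ≤ K) :
    hull (restr m K.toCloseds) = hull m :=
  hull_restr_eq m fun _ hx => atoms_inter_frontier_subset hm h
    ⟨vertices_subset_atoms m hx, vertices_subset_frontier hd m hx⟩

lemma boundaryCount_restr_of_closedCompl_le (hd : 0 < d) {m : PointMeasure E}
    (hm : m.1 (frontier (E : Set (EuclideanSpace ℝ (Fin d)))) = 0)
    {K : Compacts (EuclideanSpace ℝ (Fin d))} (h : closedCompl m ≤ K) :
    boundaryCount (restr m K.toCloseds) = boundaryCount m := by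
  rw [boundaryCount, boundaryCount, hull_restr_of_closedCompl_le hd hm h]
  change m.1.restrict K _ = _
  rw [Measure.restrict_apply isClosed_frontier.measurableSet]
  exact measure_congr_atoms m fun x hx =>
    ⟨fun h' => h'.1, fun h' => ⟨h', atoms_inter_frontier_subset hm h ⟨hx, h'⟩⟩⟩

variable [mΩ : MeasurableSpace Ω] {P : Measure Ω} {𝒩 : Ω → PointMeasure E} {lam : ℝ≥0}
  {C : Set (EuclideanSpace ℝ (Fin d))}

lemma IsPoissonPointProcess.measure_eq (h : IsPoissonPointProcess P lam C 𝒩)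
    {A : Set (EuclideanSpace ℝ (Fin d))} (hA : MeasurableSet A) (hAE : A ⊆ E) (k : ℕ) :
    P {ω | (𝒩 ω).1 A = k} = poissonMeasure (lam * (volume (A ∩ C)).toNNReal) {k} := by
  have h1 := congrArg (fun μ => μ {(k : ℝ≥0∞)}) (h.law A hA hAE)
  beta_reduce at h1
  have hm : Measurable fun ω => (𝒩 ω).1 A := (measurable_eval hA).comp h.measurable
  rw [Measure.map_apply hm (measurableSet_singleton _),
    Measure.map_apply .of_discrete (measurableSet_singleton _)] at h1
  refine h1.trans (congrArg _ ?_)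
  ext n; simp

lemma IsPoissonPointProcess.ae_measure_eq_zero [IsProbabilityMeasure P]
    (h : IsPoissonPointProcess P lam C 𝒩)
    {A : Set (EuclideanSpace ℝ (Fin d))} (hA : MeasurableSet A) (hAE : A ⊆ E)
    (h0 : volume (A ∩ C) = 0) : ∀ᵐ ω ∂P, (𝒩 ω).1 A = 0 := by
  have h1 := h.measure_eq hA hAE 0
  rw [poissonMeasure_singleton, h0] at h1
  have hm : MeasurableSet {ω | (𝒩 ω).1 A = 0} :=
    ((measurable_eval hA).comp h.measurable) (measurableSet_singleton 0)
  rw [ae_iff]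
  exact (prob_compl_eq_zero_iff hm).2 (by simpa using h1)

lemma IsPoissonPointProcess.ae_frontier [IsProbabilityMeasure P]
    (h : IsPoissonPointProcess P lam C 𝒩)
    (hE : Convex ℝ (E : Set (EuclideanSpace ℝ (Fin d)))) :
    ∀ᵐ ω ∂P, (𝒩 ω).1 (frontier (E : Set (EuclideanSpace ℝ (Fin d)))) = 0 :=
  h.ae_measure_eq_zero isClosed_frontier.measurableSet E.isCompact.isClosed.frontier_subset
    (measure_mono_null Set.inter_subset_left (hE.addHaar_frontier volume))

/-- An event that only depends on the process through `K` whenever the complement of the hull is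
contained in `K`, is, intersected with that event, in the filtration at `K`. -/
lemma IsPoissonPointProcess.measurableSet_inter [IsProbabilityMeasure P]
    (h : IsPoissonPointProcess P lam C 𝒩) (hd : 0 < d)
    (hE : Convex ℝ (E : Set (EuclideanSpace ℝ (Fin d)))) {T : Set (PointMeasure E)}
    (hT : MeasurableSet T) {K : Compacts (EuclideanSpace ℝ (Fin d))} (hK : K ≤ E)
    (hTK : ∀ m : PointMeasure E, m.1 (frontier (E : Set (EuclideanSpace ℝ (Fin d)))) = 0 →
      closedCompl m ≤ K → (m ∈ T ↔ restr m K.toCloseds ∈ T)) :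
    MeasurableSet[natFiltration P 𝒩 K] ({ω | 𝒩 ω ∈ T} ∩ {ω | closedCompl (𝒩 ω) ≤ K}) := by
  have hmeas : MeasurableSet (T ∩ {m : PointMeasure E | closedCompl m ≤ K}) := by
    simp only [closedCompl_le_iff]
    exact hT.inter (measurableSet_subset_hull _)
  refine (measurableSet_natFiltration_iff hK).2 ⟨measurable_process 𝒩 hmeas,
    _, measurable_restr 𝒩 K hmeas, ?_⟩
  filter_upwards [h.ae_frontier hE] with ω hω
  refine propext (Iff.trans (b := 𝒩 ω ∈ T ∧ closedCompl (𝒩 ω) ≤ K) Iff.rfl ?_)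
  change _ ↔ restr (𝒩 ω) K.toCloseds ∈ T ∧ closedCompl (restr (𝒩 ω) K.toCloseds) ≤ K
  constructor
  · rintro ⟨h1, h2⟩
    refine ⟨(hTK _ hω h2).1 h1, ?_⟩
    rwa [closedCompl_le_iff, hull_restr_of_closedCompl_le hd hω h2, ← closedCompl_le_iff]
  -- Restriction shrinks the hull, so if the restricted hull already covers `E \ K` the full one
  -- does too.
  · rintro ⟨h1, h2⟩
    have h2' : closedCompl (𝒩 ω) ≤ K := by
      rw [closedCompl_le_iff] at h2 ⊢
      exact h2.trans (hull_restr_subset _ _)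
    exact ⟨(hTK _ hω h2').2 h1, h2'⟩

lemma IsPoissonPointProcess.isStoppingSet [IsProbabilityMeasure P]
    (h : IsPoissonPointProcess P lam C 𝒩) (hd : 0 < d)
    (hE : Convex ℝ (E : Set (EuclideanSpace ℝ (Fin d)))) :
    IsStoppingSet E (natFiltration P 𝒩) fun ω => closedCompl (𝒩 ω) where
  subset ω := closure_minimal Set.sdiff_subset E.isCompact.isClosed
  measurable := by
    rw [totalSigma_natFiltration]
    exact @Measurable.comp _ _ _ (countSigma 𝒩 E) _ (borel _) _ _ measurable_closedCompl
      (measurable_process 𝒩)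
  measurableSet_le K hK := by
    simpa using h.measurableSet_inter hd hE (T := Set.univ) .univ hK (by simp)

lemma IsPoissonPointProcess.measurableSet_history [IsProbabilityMeasure P]
    (h : IsPoissonPointProcess P lam C 𝒩) (hd : 0 < d)
    (hE : Convex ℝ (E : Set (EuclideanSpace ℝ (Fin d)))) {T : Set (PointMeasure E)}
    (hT : MeasurableSet T)
    (hTK : ∀ (m : PointMeasure E) (K : Compacts (EuclideanSpace ℝ (Fin d))),
      m.1 (frontier (E : Set (EuclideanSpace ℝ (Fin d)))) = 0 →
      closedCompl m ≤ K → (m ∈ T ↔ restr m K.toCloseds ∈ T)) :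
    MeasurableSet[(h.isStoppingSet hd hE).history] {ω | 𝒩 ω ∈ T} :=
  ⟨by rw [totalSigma_natFiltration]; exact measurable_process 𝒩 hT,
    fun K hK => h.measurableSet_inter hd hE hT hK fun m => hTK m K⟩

lemma IsPoissonPointProcess.measurable_history [IsProbabilityMeasure P]
    (h : IsPoissonPointProcess P lam C 𝒩) (hd : 0 < d)
    (hE : Convex ℝ (E : Set (EuclideanSpace ℝ (Fin d)))) {β : Type*} [MeasurableSpace β]
    {f : PointMeasure E → β} (hf : Measurable f)
    (hfK : ∀ (m : PointMeasure E) (K : Compacts (EuclideanSpace ℝ (Fin d))),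
      m.1 (frontier (E : Set (EuclideanSpace ℝ (Fin d)))) = 0 →
      closedCompl m ≤ K → f (restr m K.toCloseds) = f m) :
    Measurable[(h.isStoppingSet hd hE).history] fun ω => f (𝒩 ω) := fun T hT =>
  h.measurableSet_history hd hE (hf hT) fun m K h1 h2 => by
    simp only [Set.mem_preimage, hfK m K h1 h2]

lemma IsPoissonPointProcess.hullSigma_le_history [IsProbabilityMeasure P]
    (h : IsPoissonPointProcess P lam C 𝒩) (hd : 0 < d)
    (hE : Convex ℝ (E : Set (EuclideanSpace ℝ (Fin d)))) :
    hullSigma P 𝒩 ≤ (h.isStoppingSet hd hE).history := by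
  refine sup_le (MeasurableSpace.generateFrom_le ?_) (MeasurableSpace.generateFrom_le ?_)
  · rintro _ ⟨B, hB, hB', -, rfl⟩
    exact h.measurableSet_history hd hE (measurableSet_hull_subset hB hB') fun m K h1 h2 => by
      simp only [Set.mem_ofPred_eq, hull_restr_of_closedCompl_le hd h1 h2]
  · rintro Z ⟨hZ, hZ0⟩
    refine ⟨by rwa [totalSigma_natFiltration], fun K hK => ?_⟩
    refine @MeasurableSet.inter _ (_) _ _ ?_ ((h.isStoppingSet hd hE).measurableSet_le K hK)
    exact (measurableSet_natFiltration_iff hK).2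
      ⟨hZ, ∅, @MeasurableSet.empty _ (_), ae_eq_empty.2 hZ0⟩

lemma history_le (h : Measurable 𝒩)
    (hK : IsStoppingSet E (natFiltration P 𝒩) fun ω => closedCompl (𝒩 ω)) :
    hK.history ≤ mΩ := fun A hA => by
  have := hA.1
  rw [totalSigma_natFiltration] at this
  exact countSigma_le h E A this

end Stopping

/-! ### Independence of the process on disjoint sets -/

section Independence

lemma measurable_apply_comap_tuple {ι β : Type*} [MeasurableSpace β] {S : Finset ι}
    (f : ι → Ω → β) {i : ι} (hi : i ∈ S) :
    Measurable[MeasurableSpace.comap (fun a (i : S) => f i a) MeasurableSpace.pi] (f i) :=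
  (@measurable_pi_iff _ _ _ (_) _ _).1 (comap_measurable fun a (i : S) => f i a) ⟨i, hi⟩

variable [mΩ : MeasurableSpace Ω] {P : Measure Ω} {𝒩 : Ω → PointMeasure E} {lam : ℝ≥0}
  {C : Set (EuclideanSpace ℝ (Fin d))}

lemma IsPoissonPointProcess.measurable_count (h : IsPoissonPointProcess P lam C 𝒩)
    {A : Set (EuclideanSpace ℝ (Fin d))} (hA : MeasurableSet A) :
    Measurable fun ω => (𝒩 ω).1 A :=
  (measurable_eval hA).comp h.measurable

lemma IsPoissonPointProcess.iIndepFun_count (h : IsPoissonPointProcess P lam C 𝒩)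
    {ι : Type*} [Finite ι] {A : ι → Set (EuclideanSpace ℝ (Fin d))}
    (hA : ∀ i, MeasurableSet (A i)) (hAE : ∀ i, A i ⊆ E)
    (hd : Pairwise fun i j => Disjoint (A i) (A j)) :
    iIndepFun (fun i ω => (𝒩 ω).1 (A i)) P := by
  have := Fintype.ofFinite ι
  let e := Fintype.equivFin ι
  have h1 := h.indep _ (fun i => A (e.symm i)) (fun i => hA _) (fun i => hAE _)
    (fun i j hij => hd (e.symm.injective.ne hij))
  simpa using h1.precomp e.injective

/-- The counts of the process inside `K` and outside `K` are independent. -/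
lemma IsPoissonPointProcess.indep_countSigma [IsProbabilityMeasure P]
    (h : IsPoissonPointProcess P lam C 𝒩)
    {K : Compacts (EuclideanSpace ℝ (Fin d))} (hK : K ≤ E)
    {A : Set (EuclideanSpace ℝ (Fin d))} (hA : MeasurableSet A) (hAE : A ⊆ E)
    (hAK : Disjoint A K) :
    Indep (countSigma 𝒩 K) (MeasurableSpace.comap (fun ω => (𝒩 ω).1 A) inferInstance) P := by
  -- Independence is checked on finite subfamilies of compact sets, then passed to their directed
  -- supremum.
  let M : Finset {U : Compacts (EuclideanSpace ℝ (Fin d)) // U ≤ K} → MeasurableSpace Ω := fun s =>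
    ⨆ U ∈ s, MeasurableSpace.comap (fun ω => (𝒩 ω).1 (U : Set (EuclideanSpace ℝ (Fin d))))
      inferInstance
  have hM : countSigma 𝒩 K ≤ ⨆ s, M s :=
    iSup₂_le fun U hU => le_iSup_of_le {⟨U, hU⟩} (le_iSup₂_of_le ⟨U, hU⟩ (by simp) le_rfl)
  have hmono : Monotone M := fun s t hst => biSup_mono fun U hU => hst hU
  refine indep_of_indep_of_le_left (indep_iSup_of_directed_le (fun s => ?_) (fun s => ?_)
    (h.measurable_count hA).comap_le hmono.directed_le) hM
  · classical
    -- Overlapping compact sets are split into the disjoint classes of points of `K` lying in the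
    -- same members of `s`. With `A` adjoined at index `none`, the counts of all classes are
    -- independent, and each original count is a sum of class counts.
    let code : EuclideanSpace ℝ (Fin d) → (s → Prop) := fun x U => x ∈ U.1.1
    have hcode : ∀ ε, MeasurableSet (code ⁻¹' {ε}) := fun ε => by
      have : code ⁻¹' {ε} = ⋂ U : s, {x | x ∈ U.1.1 ↔ ε U} := by
        ext x; simp [code, funext_iff]
      rw [this]
      refine .iInter fun U => ?_
      have hU : MeasurableSet {x | x ∈ U.1.1} := U.1.1.isCompact.measurableSet
      by_cases hε : ε U
      · simpa [hε] using hU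
      · simp only [hε, iff_false]
        exact hU.compl
    let cl : Option (s → Prop) → Set (EuclideanSpace ℝ (Fin d)) := fun o =>
      o.elim A fun ε => code ⁻¹' {ε} ∩ K
    have hcl : ∀ o, MeasurableSet (cl o) := by
      rintro (_ | ε)
      exacts [hA, (hcode ε).inter K.isCompact.measurableSet]
    have hclE : ∀ o, cl o ⊆ E := by
      rintro (_ | ε)
      exacts [hAE, Set.inter_subset_right.trans hK]
    have hdisj : Pairwise fun o o' => Disjoint (cl o) (cl o') := by
      rintro (_ | ε) (_ | ε') hne
      · exact absurd rfl hne
      · exact hAK.mono_right Set.inter_subset_right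
      · exact hAK.symm.mono_left Set.inter_subset_right
      · refine Set.disjoint_left.2 fun x hx hx' => hne ?_
        have h1 : code x = ε := hx.1
        have h2 : code x = ε' := hx'.1
        rw [← h1, ← h2]
    have hind := (h.iIndepFun_count hcl hclE hdisj).indepFun_finset
      (Finset.univ.erase none) {none} (by simp) fun o => h.measurable_count (hcl o)
    refine indep_of_indep_of_le_left (indep_of_indep_of_le_right hind ?_) ?_
    · rw [← measurable_iff_comap_le]
      exact measurable_apply_comap_tuple (fun o ω => (𝒩 ω).1 (cl o)) (i := none) (by simp)
    · refine iSup₂_le fun U hU => ?_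
      rw [← measurable_iff_comap_le]
      have hsum : (fun ω => (𝒩 ω).1 (U.1 : Set (EuclideanSpace ℝ (Fin d)))) =
          fun ω => ∑ ε ∈ Finset.univ.filter (fun ε : s → Prop => ε ⟨U, hU⟩),
            (𝒩 ω).1 (cl (some ε)) := by
        ext ω
        have h1 := sum_measure_preimage_singleton (μ := (𝒩 ω).1.restrict K)
          (Finset.univ.filter (fun ε : s → Prop => ε ⟨U, hU⟩)) (f := code) fun ε _ => hcode ε
        simp only [Measure.restrict_apply (hcode _)] at h1
        change _ = ∑ ε ∈ _, (𝒩 ω).1 (code ⁻¹' {ε} ∩ K)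
        rw [h1]
        have h2 : code ⁻¹' ↑(Finset.univ.filter (fun ε : s → Prop => ε ⟨U, hU⟩)) = U.1 := by
          ext x; simp [code]
        rw [h2, Measure.restrict_apply U.1.isCompact.measurableSet, Set.inter_eq_left.2 U.2]
      rw [hsum]
      refine Finset.measurable_sum _ fun ε _ => ?_
      exact measurable_apply_comap_tuple (fun o ω => (𝒩 ω).1 (cl o)) (i := some ε) (by simp)
  · exact iSup₂_le fun U _ => (h.measurable_count U.1.isCompact.measurableSet).comap_le

end Independence

/-! ### The conditional law of the number of interior points -/

section Conditional

/-- The complement in `E` of a finite union of cells. -/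
def outerCells (E : Compacts (EuclideanSpace ℝ (Fin d))) (I : Finset ℕ) :
    Compacts (EuclideanSpace ℝ (Fin d)) :=
  ⟨↑E \ cellUnion E I, E.isCompact.diff (isOpen_cellUnion I)⟩

lemma outerCells_le (I : Finset ℕ) : outerCells E I ≤ E := Set.sdiff_subset

lemma outerCells_anti {I J : Finset ℕ} (h : I ⊆ J) : outerCells E J ≤ outerCells E I :=
  Set.sdiff_subset_sdiff_right (Set.biUnion_subset_biUnion_left h)

lemma closedCompl_le_outerCells_iff (m : PointMeasure E) (I : Finset ℕ) :
    closedCompl m ≤ outerCells E I ↔ ∀ i ∈ I, cell E i ⊆ hull m := by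
  rw [closedCompl_le_iff]
  change ↑E \ (↑E \ cellUnion E I) ⊆ hull m ↔ _
  rw [Set.sdiff_sdiff_cancel_left (cellUnion_subset I), cellUnion, Set.iUnion₂_subset_iff]

/-- There are only finitely many atoms, so the increasing exhaustion settles on all of them
simultaneously. -/
lemma eventually_mem_cellUnion_iff (hE : Convex ℝ (E : Set (EuclideanSpace ℝ (Fin d))))
    (m : PointMeasure E) : ∀ᶠ n in Filter.atTop, ∀ x ∈ atoms m,
      x ∈ cellUnion E (fullCells m n) ↔ x ∈ interior (hull m) := by
  refine (Filter.eventually_all_finite (finite_atoms m)).2 fun x _ => ?_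
  rw [← iUnion_cellUnion_fullCells hE]
  by_cases hx : x ∈ ⋃ n, cellUnion E (fullCells m n)
  · obtain ⟨n, hn⟩ := Set.mem_iUnion.1 hx
    filter_upwards [Filter.eventually_ge_atTop n] with k hk
    exact ⟨fun _ => hx, fun _ => cellUnion_fullCells_mono m hk hn⟩
  · exact .of_forall fun n => ⟨fun h => Set.mem_iUnion.2 ⟨n, h⟩, fun h => absurd h hx⟩

variable [mΩ : MeasurableSpace Ω] {P : Measure Ω} {𝒩 : Ω → PointMeasure E} {lam : ℝ≥0}
  {C : Set (EuclideanSpace ℝ (Fin d))}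

lemma IsPoissonPointProcess.measurableSet_fullCells (h : IsPoissonPointProcess P lam C 𝒩)
    (n : ℕ) (I : Finset ℕ) : MeasurableSet {ω | fullCells (𝒩 ω) n = I} :=
  h.measurable (measurableSet_fullCells_eq n I)

/-- Exactly the cells of `I` are full when `closedCompl` lies in `outerCells E I` but in none of the
smaller sets obtained by adding a further cell `j < n`. If `I` contains an index not below `n`, the
event is empty. -/
lemma measurableSet_inter_fullCells
    {hK : IsStoppingSet E (natFiltration P 𝒩) fun ω => closedCompl (𝒩 ω)} {A : Set Ω}
    (hA : MeasurableSet[hK.history] A) (n : ℕ) (I : Finset ℕ) :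
    MeasurableSet[natFiltration P 𝒩 (outerCells E I)] (A ∩ {ω | fullCells (𝒩 ω) n = I}) := by
  by_cases hI : ∀ i ∈ I, i < n
  · have : A ∩ {ω | fullCells (𝒩 ω) n = I} = (A ∩ {ω | closedCompl (𝒩 ω) ≤ outerCells E I}) \
        ⋃ j ∈ {j | j < n ∧ j ∉ I}, {ω | closedCompl (𝒩 ω) ≤ outerCells E (insert j I)} := by
      ext ω
      simp only [closedCompl_le_outerCells_iff, Finset.ext_iff, mem_fullCells, Set.mem_inter_iff,
        Set.mem_sdiff, Set.mem_iUnion, Set.mem_ofPred_eq, Finset.mem_insert, forall_eq_or_imp,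
        not_exists, and_assoc]
      refine and_congr_right fun _ => ⟨fun H => ⟨fun i hi => ((H i).2 hi).2,
        fun j hj hj' => hj.2 ((H j).1 ⟨hj.1, hj'.1⟩)⟩, fun H i => ⟨fun hi => ?_,
        fun hi => ⟨hI i hi, H.1 i hi⟩⟩⟩
      by_contra hiI
      exact H.2 i ⟨hi.1, hiI⟩ ⟨hi.2, H.1⟩
    rw [this]
    refine @MeasurableSet.diff _ (_) _ _ (hA.2 _ (outerCells_le I)) ?_
    refine @MeasurableSet.biUnion _ _ (_) _ _ (Set.to_countable _) fun j _ => ?_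
    exact natFiltration_mono (outerCells_anti (Finset.subset_insert j I)) _
      (hK.measurableSet_le _ (outerCells_le _))
  · have : A ∩ {ω | fullCells (𝒩 ω) n = I} = ∅ := by
      refine Set.eq_empty_of_forall_notMem fun ω hω => hI fun i hi => ?_
      rw [← show fullCells (𝒩 ω) n = I from hω.2] at hi
      exact (mem_fullCells.1 hi).1
    rw [this]
    exact @MeasurableSet.empty _ (_)

lemma IsPoissonPointProcess.measure_inter_fullCells [IsProbabilityMeasure P]
    (h : IsPoissonPointProcess P lam C 𝒩)
    {hK : IsStoppingSet E (natFiltration P 𝒩) fun ω => closedCompl (𝒩 ω)} {A : Set Ω}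
    (hA : MeasurableSet[hK.history] A) (n k : ℕ) (I : Finset ℕ) :
    P ((A ∩ {ω | fullCells (𝒩 ω) n = I}) ∩ {ω | (𝒩 ω).1 (cellUnion E I) = k}) =
      poissonMeasure (lam * (volume (cellUnion E I ∩ C)).toNNReal) {k} *
        P (A ∩ {ω | fullCells (𝒩 ω) n = I}) := by
  obtain ⟨-, B, hB, hAB⟩ := (measurableSet_natFiltration_iff (outerCells_le I)).1
    (measurableSet_inter_fullCells hA n I)
  have hind := h.indep_countSigma (outerCells_le I) (isOpen_cellUnion I).measurableSet
    (cellUnion_subset I) Set.disjoint_sdiff_right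
  have hAB' : (A ∩ {ω | fullCells (𝒩 ω) n = I} ∩ {ω | (𝒩 ω).1 (cellUnion E I) = k} : Set Ω) =ᵐ[P]
      (B ∩ {ω | (𝒩 ω).1 (cellUnion E I) = k} : Set Ω) := hAB.inter (ae_eq_refl _)
  rw [measure_congr hAB', measure_congr hAB,
    ← h.measure_eq (isOpen_cellUnion I).measurableSet (cellUnion_subset I), mul_comm]
  exact (Indep_iff _ _ _).1 hind B _ hB ⟨{(k : ℝ≥0∞)}, measurableSet_singleton _, rfl⟩

lemma IsPoissonPointProcess.measure_inter_cellUnion [IsProbabilityMeasure P]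
    (h : IsPoissonPointProcess P lam C 𝒩)
    {hK : IsStoppingSet E (natFiltration P 𝒩) fun ω => closedCompl (𝒩 ω)} {A : Set Ω}
    (hA : MeasurableSet[hK.history] A) (n k : ℕ) :
    P (A ∩ {ω | (𝒩 ω).1 (cellUnion E (fullCells (𝒩 ω) n)) = k}) =
      ∫⁻ ω in A, poissonMeasure
        (lam * (volume (cellUnion E (fullCells (𝒩 ω) n) ∩ C)).toNNReal) {k} ∂P := by
  have hA' : MeasurableSet A := history_le h.measurable hK A hA
  have hm := fun I => hA'.inter (h.measurableSet_fullCells n I)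
  have hdisj : Pairwise fun I J => Disjoint (A ∩ {ω | fullCells (𝒩 ω) n = I})
      (A ∩ {ω | fullCells (𝒩 ω) n = J}) := fun I J hIJ =>
    Set.disjoint_left.2 fun ω h1 h2 => hIJ (h1.2.symm.trans h2.2)
  have hU : A = ⋃ I, A ∩ {ω | fullCells (𝒩 ω) n = I} := by ext ω; simp
  have hL : A ∩ {ω | (𝒩 ω).1 (cellUnion E (fullCells (𝒩 ω) n)) = k} =
      ⋃ I, (A ∩ {ω | fullCells (𝒩 ω) n = I}) ∩ {ω | (𝒩 ω).1 (cellUnion E I) = k} := by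
    ext ω; simp
  have hm' : ∀ I, MeasurableSet {ω | (𝒩 ω).1 (cellUnion E I) = k} := fun I =>
    h.measurable_count (isOpen_cellUnion I).measurableSet (measurableSet_singleton _)
  rw [hL, measure_iUnion (fun I J hIJ => (hdisj hIJ).mono Set.inter_subset_left
    Set.inter_subset_left) fun I => (hm I).inter (hm' I)]
  conv_rhs => rw [hU]
  rw [lintegral_iUnion hm hdisj]
  refine tsum_congr fun I => ?_
  rw [h.measure_inter_fullCells hA, ← setLIntegral_const]
  refine setLIntegral_congr_fun (hm I) fun ω hω => ?_
  rw [show fullCells (𝒩 ω) n = I from hω.2]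

lemma continuous_poissonMeasure_singleton (k : ℕ) :
    Continuous fun r : ℝ≥0 => poissonMeasure r {k} := by
  simp only [poissonMeasure_singleton]
  exact ENNReal.continuous_ofReal.comp (by fun_prop)

lemma IsPoissonPointProcess.ae_hull_subset [IsProbabilityMeasure P]
    (h : IsPoissonPointProcess P lam C 𝒩) (hC : Convex ℝ C) (hC' : IsClosed C) :
    ∀ᵐ ω ∂P, hull (𝒩 ω) ⊆ C := by
  filter_upwards [h.ae_measure_eq_zero (A := ↑E \ C)
    (E.isCompact.measurableSet.diff hC'.measurableSet) Set.sdiff_subset (by simp)] with ω hω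
  rw [hull_subset_iff _ hC]
  rw [measure_eq_zero_iff] at hω ⊢
  exact Set.disjoint_left.2 fun x hx hxa =>
    Set.disjoint_left.1 hω ⟨atoms_subset _ hxa, hx⟩ hxa

lemma tendsto_volume_cellUnion (hE : Convex ℝ (E : Set (EuclideanSpace ℝ (Fin d))))
    {m : PointMeasure E} (hm : hull m ⊆ C) :
    Filter.Tendsto (fun n => (volume (cellUnion E (fullCells m n) ∩ C)).toNNReal) Filter.atTop
      (nhds (volume (hull m)).toNNReal) := by
  refine (ENNReal.tendsto_toNNReal (isCompact_hull m).measure_ne_top).comp ?_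
  have h1 : ∀ n, cellUnion E (fullCells m n) ∩ C = cellUnion E (fullCells m n) := fun n =>
    Set.inter_eq_left.2 ((cellUnion_fullCells_subset m n).trans hm)
  simp only [h1]
  have h2 := tendsto_measure_iUnion_atTop (μ := volume) (cellUnion_fullCells_mono m)
  rwa [iUnion_cellUnion_fullCells hE, measure_congr
    (interior_ae_eq_of_null_frontier ((convex_hull m).addHaar_frontier volume))] at h2

/-- Limit of the cell identity: for each configuration the left-hand count is eventually constant,
and on the right dominated convergence applies because probabilities are bounded by one. -/
lemma IsPoissonPointProcess.measure_inter_interiorCount [IsProbabilityMeasure P]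
    (h : IsPoissonPointProcess P lam C 𝒩)
    (hE : Convex ℝ (E : Set (EuclideanSpace ℝ (Fin d)))) (hC : Convex ℝ C) (hC' : IsClosed C)
    {hK : IsStoppingSet E (natFiltration P 𝒩) fun ω => closedCompl (𝒩 ω)} {A : Set Ω}
    (hA : MeasurableSet[hK.history] A) (k : ℕ) :
    P (A ∩ {ω | interiorCount (𝒩 ω) = k}) =
      ∫⁻ ω in A, poissonMeasure (lam * (volume (hull (𝒩 ω))).toNNReal) {k} ∂P := by
  have hA' : MeasurableSet A := history_le h.measurable hK A hA
  have hmeas : ∀ n, MeasurableSet {ω | (𝒩 ω).1 (cellUnion E (fullCells (𝒩 ω) n)) = k} := fun n =>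
    measurable_of_countable_cases (h.measurableSet_fullCells n)
      (fun I => h.measurable_count (isOpen_cellUnion I).measurableSet) (measurableSet_singleton _)
  refine tendsto_nhds_unique (f := fun n =>
    P (A ∩ {ω | (𝒩 ω).1 (cellUnion E (fullCells (𝒩 ω) n)) = k})) (l := Filter.atTop) ?_ ?_
  · refine tendsto_measure_of_ae_tendsto_indicator (μ := P) Filter.atTop
      (hA'.inter ((measurable_interiorCount hE).comp h.measurable (measurableSet_singleton _)))
      (fun n => hA'.inter (hmeas n)) MeasurableSet.univ (by simp) (by simp) (.of_forall fun ω => ?_)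
    filter_upwards [eventually_mem_cellUnion_iff hE (𝒩 ω)] with n hn
    have := measure_congr_atoms (𝒩 ω) hn
    simp only [Set.mem_inter_iff, Set.mem_ofPred_eq, this]
    rfl
  · simp only [h.measure_inter_cellUnion hA]
    refine tendsto_lintegral_of_dominated_convergence (fun _ => 1) (fun n => ?_)
      (fun n => .of_forall fun ω => prob_le_one) (by simp) (ae_restrict_of_ae ?_)
    · exact measurable_of_countable_cases (h.measurableSet_fullCells n)
        (f := fun I _ => poissonMeasure (lam * (volume (cellUnion E I ∩ C)).toNNReal) {k})
        fun I => measurable_const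
    · filter_upwards [h.ae_hull_subset hC hC'] with ω hω
      exact ((continuous_poissonMeasure_singleton k).tendsto _).comp
        ((tendsto_volume_cellUnion hE hω).const_mul lam)

lemma IsPoissonPointProcess.condExp_interiorCount [IsProbabilityMeasure P]
    (h : IsPoissonPointProcess P lam C 𝒩) (hd : 0 < d)
    (hE : Convex ℝ (E : Set (EuclideanSpace ℝ (Fin d)))) (hC : Convex ℝ C) (hC' : IsClosed C)
    (k : ℕ) :
    P[Set.indicator {ω | interiorCount (𝒩 ω) = k} (fun _ => (1 : ℝ)) |
        (h.isStoppingSet hd hE).history] =ᵐ[P] fun ω =>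
          (poissonMeasure (lam * (volume (hull (𝒩 ω))).toNNReal)).real {k} := by
  have hS : MeasurableSet {ω | interiorCount (𝒩 ω) = k} :=
    (measurable_interiorCount hE).comp h.measurable (measurableSet_singleton _)
  have hf : Measurable fun m : PointMeasure E =>
      poissonMeasure (lam * (volume (hull m)).toNNReal) {k} :=
    (continuous_poissonMeasure_singleton k).measurable.comp
      (measurable_volume_hull.ennreal_toNNReal.const_mul lam)
  have hg : Measurable[(h.isStoppingSet hd hE).history] fun ω =>
      (poissonMeasure (lam * (volume (hull (𝒩 ω))).toNNReal)).real {k} :=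
    h.measurable_history hd hE hf.ennreal_toReal fun m K h1 h2 => by
      rw [hull_restr_of_closedCompl_le hd h1 h2]
  have hle := history_le h.measurable (h.isStoppingSet hd hE)
  refine (ae_eq_condExp_of_forall_setIntegral_eq hle
    ((integrable_const (1 : ℝ)).indicator hS) (fun s _ _ => ?_) (fun s hs _ => ?_)
    hg.stronglyMeasurable.aestronglyMeasurable).symm
  · refine (Integrable.of_bound (hg.mono hle le_rfl).aestronglyMeasurable 1
      (.of_forall fun ω => ?_)).integrableOn
    rw [Real.norm_of_nonneg measureReal_nonneg]
    exact measureReal_le_one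
  · rw [integral_indicator_const _ hS, measureReal_restrict_apply hS, smul_eq_mul, mul_one]
    simp only [measureReal_def]
    have hf' : Measurable fun ω => poissonMeasure (lam * (volume (hull (𝒩 ω))).toNNReal) {k} :=
      hf.comp h.measurable
    rw [integral_toReal hf'.aemeasurable (.of_forall fun ω => by simp),
      ← h.measure_inter_interiorCount hE hC hC' hs k, Set.inter_comm]

end Conditional

/-! ### Almost sure properties of the configuration -/

section AlmostSure

/-- Since `exp (-r) ≥ 1 - r`, the tail `1 - exp (-r) * (1 + r)` is at most `1 - (1 - r) * (1 + r) =
r ^ 2`. -/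
lemma poissonMeasure_two_le (r : ℝ≥0) : poissonMeasure r {n | 2 ≤ n} ≤ (r : ℝ≥0∞) ^ 2 := by
  have hc : {n : ℕ | 2 ≤ n} = {0, 1}ᶜ := by ext n; simp; omega
  have h01 : (poissonMeasure r).real {0, 1} = Real.exp (-r) * (1 + r) := by
    rw [← Set.singleton_union, measureReal_union (by simp) (measurableSet_singleton _),
      poissonMeasure_real_singleton, poissonMeasure_real_singleton]
    simp; ring
  have hreal : (poissonMeasure r).real {n | 2 ≤ n} ≤ (r : ℝ) ^ 2 := by
    rw [hc, probReal_compl_eq_one_sub (Set.toFinite _).measurableSet, h01]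
    have h1 : 1 - (r : ℝ) ≤ Real.exp (-r) := by linarith [Real.add_one_le_exp (-(r : ℝ))]
    have h2 : (1 - (r : ℝ)) * (1 + r) ≤ Real.exp (-r) * (1 + r) :=
      mul_le_mul_of_nonneg_right h1 (by positivity)
    nlinarith
  rw [← ofReal_measureReal]
  calc ENNReal.ofReal _ ≤ ENNReal.ofReal ((r : ℝ) ^ 2) := ENNReal.ofReal_le_ofReal hreal
    _ = (r : ℝ≥0∞) ^ 2 := by
      rw [ENNReal.ofReal_pow (by positivity), ENNReal.ofReal_coe_nnreal]

lemma lintegral_natCast_poissonMeasure_ne_top (r : ℝ≥0) :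
    ∫⁻ n, (n : ℝ≥0∞) ∂poissonMeasure r ≠ ∞ := by
  have hi : Integrable (fun n : ℕ => (n : ℝ)) (poissonMeasure r) := by
    rw [integrable_poissonMeasure_iff, ← summable_nat_add_iff 1]
    refine ((Real.summable_pow_div_factorial r).mul_left (Real.exp (-r) * r)).congr fun n => ?_
    rw [Real.norm_natCast, Nat.factorial_succ]
    push_cast
    field_simp
    ring
  have := hi.2
  simp only [HasFiniteIntegral, Real.enorm_natCast] at this
  exact this.ne

/-- The joint set of configurations and points on the boundary of the hull is measurable. -/
lemma measurableSet_mem_frontier_hull (hE : Convex ℝ (E : Set (EuclideanSpace ℝ (Fin d)))) :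
    MeasurableSet {p : PointMeasure E × EuclideanSpace ℝ (Fin d) | p.2 ∈ frontier (hull p.1)} := by
  have : {p : PointMeasure E × EuclideanSpace ℝ (Fin d) | p.2 ∈ frontier (hull p.1)} =
      {p | p.2 ∈ hull p.1} \ ⋃ n, ⋃ I, {m | fullCells m n = I} ×ˢ cellUnion E I := by
    ext p
    simp only [(isClosed_hull p.1).frontier_eq, ← iUnion_cellUnion_fullCells hE, Set.mem_ofPred_eq,
      Set.mem_sdiff, Set.mem_iUnion, Set.mem_prod, exists_eq_left']
  rw [this]
  exact measurableSet_mem_hull.diff (.iUnion fun n => .iUnion fun I =>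
    (measurableSet_fullCells_eq n I).prod (isOpen_cellUnion I).measurableSet)

variable [mΩ : MeasurableSpace Ω] {P : Measure Ω} {𝒩 : Ω → PointMeasure E} {lam : ℝ≥0}
  {C : Set (EuclideanSpace ℝ (Fin d))}

lemma IsPoissonPointProcess.measure_two_le_le (h : IsPoissonPointProcess P lam C 𝒩)
    {A : Set (EuclideanSpace ℝ (Fin d))} (hA : MeasurableSet A) (hAE : A ⊆ E) :
    P {ω | 2 ≤ (𝒩 ω).1 A} ≤ (lam * volume A) ^ 2 := by
  have h1 := congrArg (fun μ => μ (Set.Ici 2)) (h.law A hA hAE)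
  beta_reduce at h1
  rw [Measure.map_apply (h.measurable_count hA) measurableSet_Ici,
    Measure.map_apply .of_discrete measurableSet_Ici] at h1
  have h2 : (Nat.cast : ℕ → ℝ≥0∞) ⁻¹' Set.Ici 2 = {n | 2 ≤ n} := by
    ext n; simp
  rw [h2] at h1
  calc P {ω | 2 ≤ (𝒩 ω).1 A} = _ := h1
    _ ≤ _ := poissonMeasure_two_le _
    _ ≤ (lam * volume A) ^ 2 := by
      rw [ENNReal.coe_mul]
      gcongr
      exact ENNReal.coe_toNNReal_le_self.trans (measure_mono Set.inter_subset_left)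

/-- Almost surely, all points of the process are simple. -/
lemma IsPoissonPointProcess.ae_simple (h : IsPoissonPointProcess P lam C 𝒩) (hd : 0 < d) :
    ∀ᵐ ω ∂P, ∀ x, (𝒩 ω).1 {x} ≤ 1 := by
  have : Nonempty (Fin d) := ⟨⟨0, hd⟩⟩
  -- Partition `E` into countably many pieces of volume at most `ε`, which is possible because
  -- points are null in positive dimension. A multiple point forces a count of at least two in its
  -- piece, and the quadratic tail bound sums to a multiple of `ε`.
  have key : ∀ ε : ℝ≥0∞, 0 < ε →
      P {ω | ¬ ∀ x, (𝒩 ω).1 {x} ≤ 1} ≤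
        ε * (lam ^ 2 * volume (E : Set (EuclideanSpace ℝ (Fin d)))) := by
    intro ε hε
    classical
    let f : ℕ → Set (EuclideanSpace ℝ (Fin d)) := fun i =>
      if volume (basisSeq d i) < ε then basisSeq d i ∩ E else ∅
    have hfm : ∀ i, MeasurableSet (f i) := fun i => by
      by_cases hi : volume (basisSeq d i) < ε
      · simp only [f, hi, if_true]
        exact (isOpen_basisSeq i).measurableSet.inter E.isCompact.measurableSet
      · simp [f, hi]
    have hfE : ∀ i, f i ⊆ E := fun i => by
      by_cases hi : volume (basisSeq d i) < ε <;> simp [f, hi]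
    have hfv : ∀ i, volume (f i) ≤ ε := fun i => by
      by_cases hi : volume (basisSeq d i) < ε
      · simp only [f, hi, if_true]
        exact (measure_mono Set.inter_subset_left).trans hi.le
      · simp [f, hi]
    have hcover : (E : Set (EuclideanSpace ℝ (Fin d))) ⊆ ⋃ i, f i := fun x hx => by
      obtain ⟨U, hU, hUo, hUε⟩ := Set.exists_isOpen_lt_of_lt {x} ε
        (show volume {x} < ε by simpa using hε)
      obtain ⟨_, ⟨i, rfl⟩, hxi, hi⟩ :=
        isTopologicalBasis_basisSeq.exists_subset_of_mem_open (hU rfl) hUo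
      refine Set.mem_iUnion.2 ⟨i, ?_⟩
      simp only [f, (measure_mono hi).trans_lt hUε, if_true]
      exact ⟨hxi, hx⟩
    have hD : ∀ i, MeasurableSet (disjointed f i) := fun i => .disjointed hfm i
    have hDE : ∀ i, disjointed f i ⊆ E := fun i => (disjointed_subset f i).trans (hfE i)
    have hsub : {ω | ¬ ∀ x, (𝒩 ω).1 {x} ≤ 1} ⊆ ⋃ i, {ω | 2 ≤ (𝒩 ω).1 (disjointed f i)} := by
      intro ω hω
      obtain ⟨x, hx⟩ := not_forall.1 hω
      rw [not_le] at hx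
      have hxa : x ∈ atoms (𝒩 ω) := (zero_lt_one.trans hx).ne'
      have hxU := hcover (atoms_subset _ hxa)
      rw [← iUnion_disjointed] at hxU
      obtain ⟨i, hi⟩ := Set.mem_iUnion.1 hxU
      refine Set.mem_iUnion.2 ⟨i, ?_⟩
      have h1 : 1 < (𝒩 ω).1 (disjointed f i) :=
        hx.trans_le (measure_mono (Set.singleton_subset_iff.2 hi))
      obtain ⟨n, hn⟩ := (𝒩 ω).2.2 _ (hD i)
      change 2 ≤ (𝒩 ω).1 (disjointed f i)
      rw [hn] at h1 ⊢
      exact_mod_cast h1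
    calc P {ω | ¬ ∀ x, (𝒩 ω).1 {x} ≤ 1}
        ≤ ∑' i, P {ω | 2 ≤ (𝒩 ω).1 (disjointed f i)} :=
          (measure_mono hsub).trans (measure_iUnion_le _)
      _ ≤ ∑' i, ε * lam ^ 2 * volume (disjointed f i) := by
          refine ENNReal.tsum_le_tsum fun i => (h.measure_two_le_le (hD i) (hDE i)).trans ?_
          rw [mul_pow, sq (volume _), mul_comm ε, mul_assoc]
          gcongr
          exact (measure_mono (disjointed_subset f i)).trans (hfv i)
      _ = ε * lam ^ 2 * volume (⋃ i, disjointed f i) := by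
          rw [ENNReal.tsum_mul_left, measure_iUnion (disjoint_disjointed f) hD]
      _ ≤ _ := by
          rw [mul_assoc]
          gcongr
          exact Set.iUnion_subset hDE
  have hfin : (lam : ℝ≥0∞) ^ 2 * volume (E : Set (EuclideanSpace ℝ (Fin d))) ≠ ∞ :=
    ENNReal.mul_ne_top (by simp) E.isCompact.measure_ne_top
  have hlim : Filter.Tendsto
      (fun ε : ℝ≥0∞ => ε * (lam ^ 2 * volume (E : Set (EuclideanSpace ℝ (Fin d)))))
      (nhdsWithin 0 (Set.Ioi 0)) (nhds 0) := by
    have := (ENNReal.Tendsto.mul_const (b := (lam : ℝ≥0∞) ^ 2 *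
      volume (E : Set (EuclideanSpace ℝ (Fin d)))) (Filter.tendsto_id (x := nhds (0 : ℝ≥0∞)))
      (Or.inr hfin))
    rw [zero_mul] at this
    exact this.mono_left nhdsWithin_le_nhds
  rw [ae_iff]
  exact le_antisymm (ge_of_tendsto hlim (eventually_nhdsWithin_of_forall key)) zero_le

lemma IsPoissonPointProcess.lintegral_count_ne_top (h : IsPoissonPointProcess P lam C 𝒩) :
    ∫⁻ ω, (𝒩 ω).1 (E : Set (EuclideanSpace ℝ (Fin d))) ∂P ≠ ∞ := by
  have h1 := lintegral_map (μ := P) measurable_id (h.measurable_count E.isCompact.measurableSet)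
  simp only [id] at h1
  rw [← h1, h.law _ E.isCompact.measurableSet subset_rfl, lintegral_map measurable_id' .of_discrete]
  exact lintegral_natCast_poissonMeasure_ne_top _

/-- Almost surely, the points of the process in an open set are not on the boundary of the hull
of the points outside that open set. -/
lemma IsPoissonPointProcess.ae_notMem_frontier_hull_restr [IsProbabilityMeasure P]
    (h : IsPoissonPointProcess P lam C 𝒩)
    (hE : Convex ℝ (E : Set (EuclideanSpace ℝ (Fin d)))) {Q : Set (EuclideanSpace ℝ (Fin d))}
    (hQ : IsOpen Q) : ∀ᵐ ω ∂P, (𝒩 ω).1.restrict Q (frontier (hull (restr (𝒩 ω)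
      (Compacts.toCloseds ⟨↑E \ Q, E.isCompact.diff hQ⟩)))) = 0 := by
  set K : Compacts (EuclideanSpace ℝ (Fin d)) := ⟨↑E \ Q, E.isCompact.diff hQ⟩
  have hKE : K ≤ E := Set.sdiff_subset
  have hR : Measurable fun ω => restr (𝒩 ω) K.toCloseds :=
    (measurable_restr 𝒩 K).mono (countSigma_le h.measurable K) le_rfl
  have hcount : ∀ {t : Set (EuclideanSpace ℝ (Fin d))}, MeasurableSet t →
      Measurable fun ω => (𝒩 ω).1.restrict Q t := fun {t} ht => by
    simp only [Measure.restrict_apply ht]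
    exact h.measurable_count (ht.inter hQ.measurableSet)
  -- The points in `Q`, each paired with the configuration outside `Q`.
  let f : Ω → Measure (PointMeasure E × EuclideanSpace ℝ (Fin d)) := fun ω =>
    ((𝒩 ω).1.restrict Q).map (Prod.mk (restr (𝒩 ω) K.toCloseds))
  have hfr : ∀ (ω) {s : Set (PointMeasure E)} {t : Set (EuclideanSpace ℝ (Fin d))},
      MeasurableSet s → MeasurableSet t → f ω (s ×ˢ t) =
        ((fun ω => restr (𝒩 ω) K.toCloseds) ⁻¹' s).indicator
          (fun ω => (𝒩 ω).1.restrict Q t) ω := fun ω s t hs ht => by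
    rw [Measure.map_apply measurable_prodMk_left (hs.prod ht)]
    by_cases hω : restr (𝒩 ω) K.toCloseds ∈ s
    · rw [Set.indicator_of_mem (by exact hω), Set.mk_preimage_prod_right hω]
    · rw [Set.indicator_of_notMem (by exact hω), Set.mk_preimage_prod_right_eq_empty hω,
        measure_empty]
  have hf : Measurable f := by
    have : ∀ ω, IsFiniteMeasure (f ω) := fun ω => by
      simp only [f]; infer_instance
    have hrect : ∀ {s : Set (PointMeasure E)} {t : Set (EuclideanSpace ℝ (Fin d))},
        MeasurableSet s → MeasurableSet t → Measurable fun ω => f ω (s ×ˢ t) :=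
      fun {s t} hs ht => by
        simp only [hfr _ hs ht]
        exact (hcount ht).indicator (hR hs)
    refine Measurable.measure_of_isPiSystem generateFrom_prod.symm isPiSystem_prod ?_ ?_
    · rintro _ ⟨s, hs, t, ht, rfl⟩
      exact hrect hs ht
    · rw [← Set.univ_prod_univ]
      exact hrect .univ .univ
  have hν : Measurable fun ω => (𝒩 ω).1.restrict Q :=
    Measure.measurable_of_measurable_coe _ fun t ht => hcount ht
  have hνt : ∀ {t}, MeasurableSet t → P.bind (fun ω => (𝒩 ω).1.restrict Q) t =
      ∫⁻ ω, (𝒩 ω).1.restrict Q t ∂P := fun {t} ht => Measure.bind_apply ht hν.aemeasurable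
  have hfin : IsFiniteMeasure (P.bind fun ω => (𝒩 ω).1.restrict Q) := ⟨by
    rw [hνt .univ]
    refine lt_of_le_of_lt (lintegral_mono fun ω => ?_) h.lintegral_count_ne_top.lt_top
    rw [Measure.restrict_apply_univ]
    refine (measure_mono (Set.subset_univ Q)).trans (measure_congr_atoms _ fun x hx => ?_).le
    simp [atoms_subset _ hx]⟩
  -- Independence inside and outside `Q` makes the mean of `f` a product of the outer law and the
  -- intensity on `Q`. Finiteness of the intensity lets rectangles determine the product.
  have hprod : (P.map fun ω => restr (𝒩 ω) K.toCloseds).prod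
      (P.bind fun ω => (𝒩 ω).1.restrict Q) = P.bind f := by
    have : IsProbabilityMeasure (P.map fun ω => restr (𝒩 ω) K.toCloseds) :=
      Measure.isProbabilityMeasure_map hR.aemeasurable
    refine Measure.prod_eq fun s t hs ht => ?_
    rw [Measure.bind_apply (hs.prod ht) hf.aemeasurable, Measure.map_apply hR hs, hνt ht]
    simp only [hfr _ hs ht]
    rw [lintegral_indicator (hR hs)]
    have hcountE : (fun ω => (𝒩 ω).1.restrict Q t) = fun ω => (𝒩 ω).1 (t ∩ Q ∩ E) := by
      ext ω
      rw [Measure.restrict_apply ht]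
      exact measure_congr_atoms _ fun x hx => by simp [atoms_subset _ hx]
    rw [hcountE]
    have hm : MeasurableSet (t ∩ Q ∩ E) :=
      (ht.inter hQ.measurableSet).inter E.isCompact.measurableSet
    have hind := h.indep_countSigma hKE hm Set.inter_subset_right
      (Set.disjoint_left.2 fun x hx hx' => hx'.2 hx.1.2)
    have hs' : MeasurableSet[countSigma 𝒩 K] ((fun ω => restr (𝒩 ω) K.toCloseds) ⁻¹' s) :=
      measurable_restr 𝒩 K hs
    have hs1 : Measurable[countSigma 𝒩 K] (((fun ω => restr (𝒩 ω) K.toCloseds) ⁻¹' s).indicator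
        fun _ => (1 : ℝ≥0∞)) :=
      measurable_const.indicator hs'
    have h1 := lintegral_mul_eq_lintegral_mul_lintegral_of_independent_measurableSpace
      (countSigma_le h.measurable K) (h.measurable_count hm).comap_le hind
      (f := ((fun ω => restr (𝒩 ω) K.toCloseds) ⁻¹' s).indicator 1)
      (g := fun ω => (𝒩 ω).1 (t ∩ Q ∩ E)) hs1
      (comap_measurable _)
    rw [lintegral_indicator_one (hR hs)] at h1
    rw [← h1, ← lintegral_indicator (hR hs)]
    refine lintegral_congr fun ω => ?_
    by_cases hω : ω ∈ (fun ω => restr (𝒩 ω) K.toCloseds) ⁻¹' s <;> simp [hω]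
  have hS := measurableSet_mem_frontier_hull hE
  -- Fubini: for a fixed outer configuration the section is the boundary of a convex set, which is
  -- Lebesgue null and so carries no intensity.
  have hzero : P.bind f {p | p.2 ∈ frontier (hull p.1)} = 0 := by
    rw [← hprod, Measure.measure_prod_null hS]
    refine .of_forall fun m => ?_
    change P.bind (fun ω => (𝒩 ω).1.restrict Q) (frontier (hull m)) = 0
    have hfm : MeasurableSet (frontier (hull m)) := isClosed_frontier.measurableSet
    rw [hνt hfm, lintegral_eq_zero_iff (hcount hfm)]
    filter_upwards [h.ae_measure_eq_zero (hfm.inter E.isCompact.measurableSet)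
      Set.inter_subset_right (measure_mono_null
        (Set.inter_subset_left.trans Set.inter_subset_left)
        ((convex_hull m).addHaar_frontier volume))] with ω hω
    refine le_antisymm ((Measure.restrict_le_self _).trans ?_) zero_le
    refine (measure_congr_atoms _ fun x hx => ?_).trans_le hω.le
    simp [atoms_subset _ hx]
  have hfS : Measurable fun ω => f ω {p | p.2 ∈ frontier (hull p.1)} :=
    (Measure.measurable_coe hS).comp hf
  rw [Measure.bind_apply hS hf.aemeasurable, lintegral_eq_zero_iff hfS] at hzero
  filter_upwards [hzero] with ω hω
  change f ω _ = 0 at hω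
  rwa [Measure.map_apply measurable_prodMk_left hS] at hω

/-- Almost surely, the points of the process on the boundary of the hull are extreme. -/
lemma IsPoissonPointProcess.ae_atoms_inter_frontier_subset [IsProbabilityMeasure P]
    (h : IsPoissonPointProcess P lam C 𝒩)
    (hE : Convex ℝ (E : Set (EuclideanSpace ℝ (Fin d)))) :
    ∀ᵐ ω ∂P, atoms (𝒩 ω) ∩ frontier (hull (𝒩 ω)) ⊆ vertices (𝒩 ω) := by
  filter_upwards [ae_all_iff.2 fun i =>
    h.ae_notMem_frontier_hull_restr hE (isOpen_basisSeq i)] with ω hω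
  rintro x ⟨hx, hxf⟩
  by_contra hxv
  -- Isolate `x` from the other atoms by a basis set. Since `x` is not a vertex, discarding the
  -- points in that set leaves the hull unchanged, so `x` would lie on the boundary of a hull
  -- independent of it.
  obtain ⟨_, ⟨i, rfl⟩, hxi, hi⟩ := isTopologicalBasis_basisSeq.exists_subset_of_mem_open
    (show x ∈ (atoms (𝒩 ω) \ {x})ᶜ by simp)
    ((finite_atoms (𝒩 ω)).subset Set.sdiff_subset).isClosed.isOpen_compl
  have hω := hω i
  have hsub : vertices (𝒩 ω) ⊆ ↑E \ basisSeq d i := fun y hy =>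
    ⟨atoms_subset _ (vertices_subset_atoms _ hy), fun hyi =>
      hi hyi ⟨vertices_subset_atoms _ hy, by rintro rfl; exact hxv hy⟩⟩
  rw [hull_restr_eq (𝒩 ω) hsub, Measure.restrict_apply isClosed_frontier.measurableSet,
    measure_eq_zero_iff] at hω
  exact Set.disjoint_left.1 hω ⟨hxf, hxi⟩ hx

end AlmostSure

/-! ### The history is generated by the hull -/

section Encoding

variable {V : Type*} [NormedAddCommGroup V] [InnerProductSpace ℝ V] [SeparableSpace V]

open Classical in
/-- The half-spaces of a countable family that contain a given set. -/
def halfSpaceCode (s : Set V) : ℕ × ℚ → Bool := fun p =>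
  decide (s ⊆ halfSpace (denseSeq V p.1) p.2)

lemma halfSpaceCode_eq_true {s : Set V} {p : ℕ × ℚ} :
    halfSpaceCode s p = true ↔ s ⊆ halfSpace (denseSeq V p.1) p.2 := by
  simp [halfSpaceCode]

lemma mem_iff_halfSpaceCode [CompleteSpace V] {s : Set V} (hs : IsCompact s) (hs' : Convex ℝ s)
    {x : V} : x ∈ s ↔ ∀ p : ℕ × ℚ, halfSpaceCode s p = true →
      x ∈ halfSpace (denseSeq V p.1) p.2 := by
  simp only [halfSpaceCode_eq_true]
  refine ⟨fun hx p hp => hp hx, fun H => ?_⟩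
  by_contra hx
  obtain ⟨n, q, h1, h2⟩ := exists_halfSpace_separating hs hs' hx
  exact absurd (H (n, q) h1) (not_le.2 h2)

lemma halfSpaceCode_injOn [CompleteSpace V] :
    Set.InjOn (halfSpaceCode (V := V)) {s | IsCompact s ∧ Convex ℝ s} := fun s hs t ht hst => by
  ext x
  rw [mem_iff_halfSpaceCode hs.1 hs.2, mem_iff_halfSpaceCode ht.1 ht.2, hst]

end Encoding

/-! ### Recovering the vertices of a polytope measurably from its code -/

section Extreme

lemma measurable_sum_dirac {V : Type*} [MeasurableSpace V] (k : ℕ) :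
    Measurable fun x : Fin k → V => ∑ i, Measure.dirac (x i) := by
  refine Measure.measurable_of_measurable_coe _ fun s hs => ?_
  simp only [Measure.coe_finsetSum, Finset.sum_apply]
  exact Finset.measurable_sum _ fun i _ =>
    (Measure.measurable_coe hs).comp (Measure.measurable_dirac.comp (measurable_pi_apply i))

variable {V : Type*} [NormedAddCommGroup V] [InnerProductSpace ℝ V]

/-- The sum of the Dirac measures at the extreme points of a set. -/
def extremeMeasure [MeasurableSpace V] (s : Set V) : Measure V :=
  ∑ᶠ y ∈ s.extremePoints ℝ, Measure.dirac y

/-- The tuples in convex position: no point is in the convex hull of the others. -/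
def convexPosition (V : Type*) [NormedAddCommGroup V] [InnerProductSpace ℝ V] (k : ℕ) :
    Set (Fin k → V) := {x | ∀ i, x i ∉ convexHull ℝ (x '' {i}ᶜ)}

lemma injective_of_mem_convexPosition {k : ℕ} {x : Fin k → V} (hx : x ∈ convexPosition V k) :
    Function.Injective x := fun i j hij => by
  by_contra hne
  exact hx i (subset_convexHull ℝ _ ⟨j, Ne.symm hne, hij.symm⟩)

lemma extremePoints_convexHull_range {k : ℕ} {x : Fin k → V} (hx : x ∈ convexPosition V k) :
    (convexHull ℝ (Set.range x)).extremePoints ℝ = Set.range x := by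
  refine extremePoints_convexHull_subset.antisymm ?_
  rintro _ ⟨i, rfl⟩
  refine mem_extremePoints_of_notMem_convexHull (Set.finite_range x) ⟨i, rfl⟩ fun h => hx i ?_
  refine convexHull_mono ?_ h
  rintro _ ⟨⟨j, rfl⟩, hj⟩
  exact ⟨j, fun hji => hj (by rw [show j = i from hji]; rfl), rfl⟩

variable [MeasurableSpace V]

lemma extremeMeasure_convexHull_range {k : ℕ} {x : Fin k → V} (hx : x ∈ convexPosition V k) :
    extremeMeasure (convexHull ℝ (Set.range x)) = ∑ i, Measure.dirac (x i) := by
  rw [extremeMeasure, extremePoints_convexHull_range hx,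
    finsum_mem_range (injective_of_mem_convexPosition hx), finsum_eq_sum_of_fintype]

variable [BorelSpace V] [SecondCountableTopology V]

lemma measurable_halfSpaceCode_range (k : ℕ) :
    Measurable fun x : Fin k → V => halfSpaceCode (convexHull ℝ (Set.range x)) := by
  refine measurable_pi_iff.2 fun p => measurable_to_bool ?_
  have : (fun x : Fin k → V => halfSpaceCode (convexHull ℝ (Set.range x)) p) ⁻¹' {true} =
      ⋂ i, {x | x i ∈ halfSpace (denseSeq V p.1) p.2} := by
    ext x
    simp only [Set.mem_preimage, Set.mem_singleton_iff, halfSpaceCode_eq_true,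
      (convex_halfSpace _ _).convexHull_subset_iff, Set.range_subset_iff, Set.mem_iInter,
      Set.mem_ofPred_eq]
  rw [this]
  exact .iInter fun i => measurable_pi_apply i (isClosed_halfSpace _ _).measurableSet

variable [CompleteSpace V]

lemma measurableSet_convexPosition (k : ℕ) : MeasurableSet (convexPosition V k) := by
  have : convexPosition V k = ⋂ i, ⋃ p : ℕ × ℚ,
      (⋂ j : ({i}ᶜ : Set (Fin k)), {x | x j ∈ halfSpace (denseSeq V p.1) p.2}) ∩
        {x | x i ∈ halfSpace (denseSeq V p.1) p.2}ᶜ := by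
    ext x
    simp only [convexPosition, Set.mem_ofPred_eq, Set.mem_iInter, Set.mem_iUnion, Set.mem_inter_iff,
      Set.mem_compl_iff]
    refine forall_congr' fun i => ⟨fun hi => ?_, ?_⟩
    · obtain ⟨n, q, h1, h2⟩ := exists_halfSpace_separating
        ((Set.toFinite (x '' {i}ᶜ)).isCompact_convexHull ℝ) (convex_convexHull ℝ _) hi
      exact ⟨(n, q), fun j => h1 (subset_convexHull ℝ _ ⟨j, j.2, rfl⟩), not_le.2 h2⟩
    · rintro ⟨p, h1, h2⟩ hi
      refine h2 (convexHull_min ?_ (convex_halfSpace _ _) hi)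
      rintro _ ⟨j, hj, rfl⟩
      exact h1 ⟨j, hj⟩
  rw [this]
  have hm : ∀ (j : Fin k) (p : ℕ × ℚ),
      MeasurableSet {x : Fin k → V | x j ∈ halfSpace (denseSeq V p.1) p.2} := fun j p =>
    measurable_pi_apply j (isClosed_halfSpace _ _).measurableSet
  exact .iInter fun i => .iUnion fun p =>
    (MeasurableSet.iInter fun j : ({i}ᶜ : Set (Fin k)) => hm j p).inter (hm i p).compl

/-- The extreme points of a polytope depend measurably on the half-spaces that contain it. -/
lemma exists_measurableSet_extremeMeasure {S : Set (Measure V)} (hS : MeasurableSet S) :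
    ∃ T : Set (ℕ × ℚ → Bool), MeasurableSet T ∧ ∀ (k : ℕ), ∀ x ∈ convexPosition V k,
      (extremeMeasure (convexHull ℝ (Set.range x)) ∈ S ↔
        halfSpaceCode (convexHull ℝ (Set.range x)) ∈ T) := by
  let img : Set (Measure V) → Set (ℕ × ℚ → Bool) := fun S => ⋃ k,
    (fun x : Fin k → V => halfSpaceCode (convexHull ℝ (Set.range x))) ''
      (convexPosition V k ∩ (fun x => ∑ i, Measure.dirac (x i)) ⁻¹' S)
  have himg : ∀ {S}, MeasurableSet S → AnalyticSet (img S) := fun {S} hS =>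
    .iUnion fun k => ((measurableSet_convexPosition k).inter
      (measurable_sum_dirac k hS)).analyticSet_image (measurable_halfSpaceCode_range k)
  have hdisj : Disjoint (img S) (img Sᶜ) := by
    refine Set.disjoint_left.2 fun c hc hc' => ?_
    obtain ⟨k, x, ⟨hx, hxS⟩, rfl⟩ := Set.mem_iUnion.1 hc
    obtain ⟨l, y, ⟨hy, hyS⟩, hxy⟩ := Set.mem_iUnion.1 hc'
    have hcc : ∀ {j} (z : Fin j → V), convexHull ℝ (Set.range z) ∈
        {s | IsCompact s ∧ Convex ℝ s} := fun z =>
      ⟨(Set.finite_range z).isCompact_convexHull ℝ, convex_convexHull ℝ _⟩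
    have heq := halfSpaceCode_injOn (hcc y) (hcc x) hxy
    apply hyS
    change ∑ i, Measure.dirac (y i) ∈ S
    rw [← extremeMeasure_convexHull_range hy, heq, extremeMeasure_convexHull_range hx]
    exact hxS
  -- Lusin separation: the two sets of codes are analytic, and disjoint because a code determines
  -- its polytope and hence its vertices.
  obtain ⟨T, hT1, hT2, hT⟩ := (himg hS).measurablySeparable (himg hS.compl) hdisj
  refine ⟨T, hT, fun k x hx => ?_⟩
  rw [extremeMeasure_convexHull_range hx]
  refine ⟨fun h => hT1 (Set.mem_iUnion.2 ⟨k, x, ⟨hx, h⟩, rfl⟩), fun h => ?_⟩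
  by_contra hS
  exact Set.disjoint_left.1 hT2 (Set.mem_iUnion.2 ⟨k, x, ⟨hx, hS⟩, rfl⟩) h

end Extreme

/-! ### Identifying the history with the completed σ-algebra of the hull -/

section History

lemma exists_convexPosition_hull (m : PointMeasure E) :
    ∃ (k : ℕ) (x : Fin k → EuclideanSpace ℝ (Fin d)), x ∈ convexPosition _ k ∧
      convexHull ℝ (Set.range x) = hull m := by
  obtain ⟨k, x, hx⟩ := (finite_vertices m).fin_embedding
  refine ⟨k, x, fun i hi => ?_, by rw [hx, convexHull_vertices]⟩
  have hxi : x i ∈ vertices m := hx ▸ ⟨i, rfl⟩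
  -- Removing an extreme point leaves a convex set, which still contains the hull of the other
  -- vertices.
  have hconv := ((convex_hull m).mem_extremePoints_iff_convex_sdiff.1 hxi).2
  refine (convexHull_min ?_ hconv hi).2 rfl
  rintro _ ⟨j, hj, rfl⟩
  have hxj : x j ∈ vertices m := hx ▸ ⟨j, rfl⟩
  exact ⟨hxj.1, fun h => hj (x.injective h)⟩

/-- Outside the cells filled by the hull, a simple configuration whose boundary points are extreme
consists of the extreme points of the hull. -/
lemma restr_outerCells_eq (hd : 0 < d) {m : PointMeasure E} (hsimple : ∀ x, m.1 {x} ≤ 1)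
    (hext : atoms m ∩ frontier (hull m) ⊆ vertices m) {I : Finset ℕ}
    (hI : ∀ x ∈ atoms m, x ∈ cellUnion E I ↔ x ∈ interior (hull m)) :
    (restr m (outerCells E I).toCloseds).1 = extremeMeasure (hull m) := by
  refine Measure.ext fun A hA => ?_
  have hfin := finite_vertices m
  change m.1.restrict (outerCells E I) A = (∑ᶠ y ∈ vertices m, Measure.dirac y) A
  rw [finsum_mem_eq_finite_toFinset_sum _ hfin, Measure.restrict_apply hA, Measure.finsetSum_apply]
  have h1 : m.1 (A ∩ outerCells E I) = m.1 (⋃ y ∈ hfin.toFinset, A ∩ {y}) := by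
    refine measure_congr_atoms m fun x hx => ?_
    simp only [Set.mem_inter_iff, Set.mem_iUnion, Set.Finite.mem_toFinset, Set.mem_singleton_iff,
      exists_prop, exists_eq_right_right']
    rw [and_comm]
    refine and_congr_left fun _ => ?_
    change x ∈ (E : Set (EuclideanSpace ℝ (Fin d))) ∧ x ∉ cellUnion E I ↔ _
    rw [hI x hx]
    constructor
    · intro hx'
      refine hext ⟨hx, ?_⟩
      rw [(isClosed_hull m).frontier_eq]
      exact ⟨atoms_subset_hull m hx, hx'.2⟩
    · intro hx'
      have := vertices_subset_frontier hd m hx'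
      rw [(isClosed_hull m).frontier_eq] at this
      exact ⟨atoms_subset m hx, this.2⟩
  rw [h1, measure_biUnion_finset]
  · refine Finset.sum_congr rfl fun y hy => ?_
    rw [Measure.dirac_apply' _ hA]
    by_cases hyA : y ∈ A
    · rw [Set.inter_eq_right.2 (Set.singleton_subset_iff.2 hyA), Set.indicator_of_mem hyA]
      exact le_antisymm (hsimple y) (one_le_of_ne_zero m (measurableSet_singleton y)
        (vertices_subset_atoms m (hfin.mem_toFinset.1 hy)))
    · rw [Set.indicator_of_notMem hyA, Set.inter_singleton_eq_empty.2 hyA, measure_empty]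
  · intro y _ z _ hyz
    exact (Set.disjoint_singleton.2 hyz).mono Set.inter_subset_right Set.inter_subset_right
  · exact fun y _ => hA.inter (measurableSet_singleton y)

/-- The events `{hull ⊆ B}` with `B` closed and convex generate the code of the hull. -/
lemma measurable_halfSpaceCode_hull (hE : Convex ℝ (E : Set (EuclideanSpace ℝ (Fin d))))
    (𝒩 : Ω → PointMeasure E) :
    Measurable[MeasurableSpace.generateFrom
      {s | ∃ B : Set (EuclideanSpace ℝ (Fin d)), Convex ℝ B ∧ IsClosed B ∧ B ⊆ E ∧
        s = {ω | hull (𝒩 ω) ⊆ B}}] fun ω => halfSpaceCode (hull (𝒩 ω)) := by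
  refine (@measurable_pi_iff _ _ _ (_) _ _).2 fun p => measurable_to_bool ?_
  refine MeasurableSpace.measurableSet_generateFrom
    -- Intersecting with `E` makes the test set admissible without changing the event, as the hull
    -- lies in `E`.
    ⟨halfSpace (denseSeq _ p.1) p.2 ∩ E, (convex_halfSpace _ _).inter hE,
      (isClosed_halfSpace _ _).inter E.isCompact.isClosed, Set.inter_subset_right, ?_⟩
  ext ω
  simp [halfSpaceCode_eq_true, hull_subset hE]

lemma exists_measurableSet_subset_hull (W : Set (EuclideanSpace ℝ (Fin d))) :
    ∃ T : Set (ℕ × ℚ → Bool), MeasurableSet T ∧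
      ∀ m : PointMeasure E, W ⊆ hull m ↔ halfSpaceCode (hull m) ∈ T := by
  refine ⟨⋂ p : ℕ × ℚ, {c | c p = true → W ⊆ halfSpace (denseSeq _ p.1) p.2},
    .iInter fun p => ?_, fun m => ?_⟩
  · have hb : MeasurableSet {b : Bool | b = true → W ⊆ halfSpace (denseSeq _ p.1) p.2} :=
      .of_discrete
    exact measurable_pi_apply (X := fun _ => Bool) p hb
  · simp only [Set.mem_iInter, Set.mem_ofPred_eq]
    refine ⟨fun h p hp => h.trans (halfSpaceCode_eq_true.1 hp), fun h x hx => ?_⟩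
    exact (mem_iff_halfSpaceCode (isCompact_hull m) (convex_hull m)).2 fun p hp => h p hp hx

lemma generateFrom_hull_le {𝒩 : Ω → PointMeasure E} :
    MeasurableSpace.generateFrom
      {s | ∃ B : Set (EuclideanSpace ℝ (Fin d)), Convex ℝ B ∧ IsClosed B ∧ B ⊆ E ∧
        s = {ω | hull (𝒩 ω) ⊆ B}} ≤ countSigma 𝒩 E := by
  refine MeasurableSpace.generateFrom_le ?_
  rintro _ ⟨B, hB, hB', -, rfl⟩
  exact measurable_process 𝒩 (measurableSet_hull_subset hB hB')

variable [mΩ : MeasurableSpace Ω] {P : Measure Ω} {𝒩 : Ω → PointMeasure E} {lam : ℝ≥0}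
  {C : Set (EuclideanSpace ℝ (Fin d))}

lemma IsPoissonPointProcess.history_le_hullSigma [IsProbabilityMeasure P]
    (h : IsPoissonPointProcess P lam C 𝒩) (hd : 0 < d)
    (hE : Convex ℝ (E : Set (EuclideanSpace ℝ (Fin d)))) :
    (h.isStoppingSet hd hE).history ≤ hullSigma P 𝒩 := fun A hA => by
  have hA1 := hA.1
  rw [totalSigma_natFiltration] at hA1
  refine (measurableSet_complete_iff generateFrom_hull_le).2 ⟨hA1, ?_⟩
  -- For each of the countably many `I`, the part of `A` where the cells of `I` are full is almost
  -- surely a condition on the process outside them.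
  have hchoice : ∀ I : Finset ℕ, ∃ S : Set (Measure (EuclideanSpace ℝ (Fin d))), MeasurableSet S ∧
      ∀ᵐ ω ∂P, (ω ∈ A ∧ closedCompl (𝒩 ω) ≤ outerCells E I ↔
        (restr (𝒩 ω) (outerCells E I).toCloseds).1 ∈ S) := fun I => by
    obtain ⟨-, B, hB, hAB⟩ := (measurableSet_natFiltration_iff (outerCells_le I)).1
      (hA.2 _ (outerCells_le I))
    rw [countSigma_eq_comap] at hB
    obtain ⟨_, ⟨S, hS, rfl⟩, rfl⟩ := hB
    exact ⟨S, hS, hAB.mem_iff⟩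
  choose S hS hSA using hchoice
  choose T hT hTS using fun I => exists_measurableSet_extremeMeasure (hS I)
  -- Only for large `n` do the full cells contain every interior atom, leaving just the vertices
  -- outside. The representing event is therefore taken eventually in `n`, with the index set itself
  -- read from the hull.
  refine ⟨{ω | ∀ᶠ n in Filter.atTop, halfSpaceCode (hull (𝒩 ω)) ∈ T (fullCells (𝒩 ω) n)}, ?_, ?_⟩
  · have hcode := measurable_halfSpaceCode_hull hE 𝒩
    simp only [Filter.eventually_atTop, Set.ofPred_exists, Set.ofPred_forall]
    refine @MeasurableSet.iUnion _ _ (_) _ _ fun N => @MeasurableSet.iInter _ _ (_) _ _ fun n =>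
      @MeasurableSet.iInter _ _ (_) _ _ fun _ => ?_
    have hU : {ω | halfSpaceCode (hull (𝒩 ω)) ∈ T (fullCells (𝒩 ω) n)} =
        ⋃ I, {ω | fullCells (𝒩 ω) n = I} ∩ {ω | halfSpaceCode (hull (𝒩 ω)) ∈ T I} := by
      ext ω; simp
    rw [hU]
    refine @MeasurableSet.iUnion _ _ (_) _ _ fun I => @MeasurableSet.inter _ (_) _ _ ?_
      (hcode (hT I))
    refine @measurableSet_fullCells_eq_of _ _ _ (_) _ (fun i => ?_) n I
    obtain ⟨W, hW, hWi⟩ := exists_measurableSet_subset_hull (E := E) (cell E i)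
    simp only [hWi]
    exact hcode hW
  · filter_upwards [h.ae_simple hd, h.ae_atoms_inter_frontier_subset hE, ae_all_iff.2 hSA]
      with ω h1 h2 h3
    have key : ∀ᶠ n in Filter.atTop,
        (ω ∈ A ↔ halfSpaceCode (hull (𝒩 ω)) ∈ T (fullCells (𝒩 ω) n)) := by
      filter_upwards [eventually_mem_cellUnion_iff hE (𝒩 ω)] with n hn
      obtain ⟨k, x, hx, hxh⟩ := exists_convexPosition_hull (𝒩 ω)
      have hle : closedCompl (𝒩 ω) ≤ outerCells E (fullCells (𝒩 ω) n) :=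
        (closedCompl_le_outerCells_iff _ _).2 fun i hi => (mem_fullCells.1 hi).2
      have h4 := h3 (fullCells (𝒩 ω) n)
      have h5 := hTS (fullCells (𝒩 ω) n) k x hx
      rw [restr_outerCells_eq hd h1 h2 hn] at h4
      rw [hxh] at h5
      rw [← h5, ← h4]
      exact (and_iff_left hle).symm
    refine propext (show ω ∈ A ↔ ∀ᶠ n in Filter.atTop, _ from ⟨fun hω => ?_, fun hω => ?_⟩)
    · exact key.mono fun n hn => hn.1 hω
    · obtain ⟨n, hn1, hn2⟩ := (key.and hω).exists
      exact hn1.2 hn2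

end History

end HullPPP

end

theorem mainTheorem5 {d : ℕ} (hd : 0 < d)
    (E : Compacts (EuclideanSpace ℝ (Fin d)))
    (hE : Convex ℝ (E : Set (EuclideanSpace ℝ (Fin d))))
    (hE' : (interior (E : Set (EuclideanSpace ℝ (Fin d)))).Nonempty)
    (C : Set (EuclideanSpace ℝ (Fin d))) (hC : Convex ℝ C) (hC' : IsClosed C) (hCE : C ⊆ E)
    (hCvol : 0 < volume C)
    (lam : ℝ≥0) (hlam : 0 < lam)
    {Ω : Type*} [mΩ : MeasurableSpace Ω] (P : Measure Ω) [IsProbabilityMeasure P]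
    (𝒩 : Ω → HullPPP.PointMeasure E) (h𝒩 : HullPPP.IsPoissonPointProcess P lam C 𝒩) :
    ∃ hK : HullPPP.IsStoppingSet E (HullPPP.natFiltration P 𝒩)
        (fun ω => HullPPP.closedCompl (𝒩 ω)),
      hK.history ≤ mΩ ∧
      Measurable[hK.history] (fun ω => HullPPP.boundaryCount (𝒩 ω)) ∧
      Measurable (fun ω => HullPPP.interiorCount (𝒩 ω)) ∧
      (∀ k : ℕ,
        P[Set.indicator {ω | HullPPP.interiorCount (𝒩 ω) = k} (fun _ => (1 : ℝ)) | hK.history]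
          =ᵐ[P] fun ω =>
            (poissonMeasure (lam * (volume (HullPPP.hull (𝒩 ω))).toNNReal)).real {k}) ∧
      hK.history = HullPPP.hullSigma P 𝒩 := by
  refine ⟨h𝒩.isStoppingSet hd hE, HullPPP.history_le h𝒩.measurable _,
    h𝒩.measurable_history hd hE (HullPPP.measurable_boundaryCount hE) fun m K h1 h2 =>
      HullPPP.boundaryCount_restr_of_closedCompl_le hd h1 h2,
    (HullPPP.measurable_interiorCount hE).comp h𝒩.measurable,
    h𝒩.condExp_interiorCount hd hE hC hC',
    le_antisymm (h𝒩.history_le_hullSigma hd hE) (h𝒩.hullSigma_le_history hd hE)⟩
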